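/- A total coloring of a finite simple graph $G$ assigns a color to every vertex and every edge of $G$ so that adjacent vertices, distinct edges with a common end, and a vertex and an edge incident with it, always get distinct colors; the total chromatic number $\chi''(G)$ is the least number of colors in a total coloring of $G$. A graph is Halin if it can be obtained from a plane embedding of a finite tree with at least three leaves by adding a cycle that passes through exactly the leaves and creates no crossing edges, that is, that visits the leaves in the order in which they occur along the boundary of the embedded tree; vertices of degree two are allowed in the tree. A graph is subcubic if its maximum degree is at most $3$. Let $K_4$ be the complete graph on four vertices, and let $H_3, H_4, H_5, H_8$ be the following Halin graphs, where the peripheral cycle of $H_i$ is the cycle $0\,1\,2\cdots(\ell-1)\,0$ on its $\ell$ leaves and the remaining edges (those of the tree) are listed. - $H_3$ ($\ell=4$, vertices $0,\dots,6$): $\{0,4\},\{1,5\},\{2,6\},\{3,6\},\{4,5\},\{5,6\}$. - $H_4$ ($\ell=6$, vertices $0,\dots,9$): $\{0,6\},\{1,6\},\{2,7\},\{3,8\},\{4,9\},\{5,9\},\{6,7\},\{7,8\},\{8,9\}$. - $H_5$ ($\ell=7$, vertices $0,\dots,11$): $\{0,7\},\{1,7\},\{2,8\},\{3,9\},\{4,10\},\{5,11\},\{6,11\},\{7,8\},\{8,9\},\{9,10\},\{10,11\}$.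 - $H_8$ ($\ell=10$, vertices $0,\dots,17$): $\{0,10\},\{1,10\},\{2,11\},\{3,12\},\{4,14\},\{5,14\},\{6,15\},\{7,16\},\{8,17\},\{9,17\},\{10,11\},\{11,12\},\{12,13\},\{13,14\},\{13,15\},\{15,16\},\{16,17\}$. **Theorem.** Let $H$ be a subcubic Halin graph that is not isomorphic to any of $K_4, H_4, H_5, H_8, H_3$. Then $\chi''(H)=4$. -/

import Mathlib

/-- The elements of a graph: its vertices and its edges. The vertices of the *total graph* of `G`
are the elements of `G`, two of them being joined if they are adjacent vertices, a vertex and an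
edge incident with it, or two distinct edges with a common end. -/
def totalGraph {V : Type*} (G : SimpleGraph V) : SimpleGraph (V ⊕ G.edgeSet) :=
  SimpleGraph.fromRel fun x y =>
    match x, y with
    | Sum.inl u, Sum.inl v => G.Adj u v
    | Sum.inl u, Sum.inr e => u ∈ (e : Sym2 V)
    | Sum.inr _, Sum.inl _ => False
    | Sum.inr e, Sum.inr f => ∃ v, v ∈ (e : Sym2 V) ∧ v ∈ (f : Sym2 V)

/-- The total chromatic number `χ''(G)`: the least number of colors in a total coloring of `G`, which
gives a color to every vertex and every edge so that adjacent or incident elements get distinct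
colors. Such a coloring is a proper vertex coloring of the total graph. -/
noncomputable def totalChromaticNumber {V : Type*} (G : SimpleGraph V) : ℕ∞ :=
  (totalGraph G).chromaticNumber

/-- A leaf is a vertex with exactly one neighbor. -/
def IsLeaf {V : Type*} (T : SimpleGraph V) (v : V) : Prop :=
  ∃! w, T.Adj v w

/-- A rotation system on `T`: for every vertex, a cyclic order of the darts (oriented edges) that
leave it. `rot d` is the dart that follows `d` around the vertex `d.fst`. For a finite tree every
rotation system has exactly one face, so these are exactly the embeddings of the tree in the
(oriented) plane, up to homeomorphism. -/
structure RotationSystem {V : Type*} (T : SimpleGraph V) where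
  /-- The successor of a dart in the cyclic order around its first vertex. -/
  rot : Equiv.Perm T.Dart
  /-- Rotating does not change the vertex. -/
  fst_rot : ∀ d : T.Dart, (rot d).fst = d.fst
  /-- All the darts leaving a vertex form a single cycle. -/
  sameCycle : ∀ d d' : T.Dart, d.fst = d'.fst → rot.SameCycle d d'

/-- One step of the walk along the boundary of a face: traverse the dart `d` and leave its second
vertex through the dart that comes next, after the reverse of `d`, in the cyclic order there. -/
def RotationSystem.faceStep {V : Type*} {T : SimpleGraph V} (R : RotationSystem T)
    (d : T.Dart) : T.Dart :=
  R.rot d.symm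

/-- `v` is the leaf met next after the leaf `u` on the walk along the boundary of the embedded
tree. -/
def RotationSystem.NextLeaf {V : Type*} {T : SimpleGraph V} (R : RotationSystem T)
    (u v : V) : Prop :=
  IsLeaf T u ∧ IsLeaf T v ∧ ∃ d : T.Dart, d.fst = u ∧ ∃ n : ℕ, 0 < n ∧
    (R.faceStep^[n] d).fst = v ∧ ∀ k : ℕ, 0 < k → k < n → ¬ IsLeaf T (R.faceStep^[k] d).fst

/-- A *Halin graph*: it is obtained from a plane embedding of a tree with at least three leaves by
adding the cycle through all the leaves that crosses no edge, that is, the cycle that visits the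
leaves in the order in which they occur along the boundary of the embedded tree. Vertices of degree
two are allowed in the tree. -/
def IsHalin {V : Type*} (H : SimpleGraph V) : Prop :=
  ∃ T : SimpleGraph V, T.IsTree ∧ 3 ≤ {v | IsLeaf T v}.ncard ∧
    ∃ R : RotationSystem T, ∀ u v : V,
      H.Adj u v ↔ T.Adj u v ∨ R.NextLeaf u v ∨ R.NextLeaf v u

/-- The simple graph on `{0, …, n - 1}` with the listed edges. -/
def graphOfEdges (n : ℕ) (E : List (Fin n × Fin n)) : SimpleGraph (Fin n) :=
  SimpleGraph.fromRel fun a b => (a, b) ∈ E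

/-- The complete graph on four vertices. -/
def halinK4 : SimpleGraph (Fin 4) := ⊤

/-- The graph `H₃`: peripheral cycle `0, …, 3`, spanning vertices `4, 5, 6`; `4` has degree two. -/
def halinH3 : SimpleGraph (Fin 7) := graphOfEdges 7
  [(0, 1), (1, 2), (2, 3), (3, 0),
   (0, 4), (1, 5), (2, 6), (3, 6),
   (4, 5), (5, 6)]

/-- The cubic graph `H₄`: peripheral cycle `0, …, 5`, spanning vertices `6, …, 9`. -/
def halinH4 : SimpleGraph (Fin 10) := graphOfEdges 10
  [(0, 1), (1, 2), (2, 3), (3, 4), (4, 5), (5, 0),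
   (0, 6), (1, 6), (2, 7), (3, 8), (4, 9), (5, 9),
   (6, 7), (7, 8), (8, 9)]

/-- The cubic graph `H₅`: peripheral cycle `0, …, 6`, spanning vertices `7, …, 11`. -/
def halinH5 : SimpleGraph (Fin 12) := graphOfEdges 12
  [(0, 1), (1, 2), (2, 3), (3, 4), (4, 5), (5, 6), (6, 0),
   (0, 7), (1, 7), (2, 8), (3, 9), (4, 10), (5, 11), (6, 11),
   (7, 8), (8, 9), (9, 10), (10, 11)]

/-- The cubic graph `H₈`: peripheral cycle `0, …, 9`, spanning vertices `10, …, 17`. -/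
def halinH8 : SimpleGraph (Fin 18) := graphOfEdges 18
  [(0, 1), (1, 2), (2, 3), (3, 4), (4, 5), (5, 6), (6, 7), (7, 8), (8, 9), (9, 0),
   (0, 10), (1, 10), (2, 11), (3, 12), (4, 14), (5, 14), (6, 15), (7, 16), (8, 17), (9, 17),
   (10, 11), (11, 12), (12, 13), (13, 14), (13, 15), (15, 16), (16, 17)]

/-! Choose a leaf `r` of the tree of the Halin graph. Since degrees are at most three, what hangs
from `r` is a plane tree with at most two children at each vertex. The Halin graph is the `closure`
of that plane tree: `r` is joined to its root, its first leaf and its last leaf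
(`IsHalin.exists_iso_closure`). Already `r` and its three edges need four colors, so it remains to
find a total coloring of the closure with four colors.

A plane tree with the path through its leaves meets the rest of the graph only at three ports: at
the root, the first leaf and the last leaf. All that matters is which triples of port colors extend
to the tree. Permuting colors normalizes the root port to `(0, 1)`, which leaves a set of pairs of
leaf ports, a 12 × 12 Boolean matrix. Adding a new root above one or two trees acts on these
matrices, for two trees by Boolean matrix products (`Realizes.sub`, `Realizes.node`).

Lower bounds on these sets suffice, and any part of a lower bound is again one. This makes the
problem finite. The list `masks` is closed in the sense that combining members yields a matrix that
contains a member (`coversNodes_masks`, `covers_sub_masks`), and each member contains a pair that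
can be completed at `r` (`closable_masks`). By induction every plane tree is a path, or one of the
finitely many `trees`, or realizes a member of `masks` (`mem_trees_or_realizes`). The members of
`trees` are inspected one by one: each is a path, or its own mask can be completed, or its closure
is one of the five excluded graphs. -/

/-! ### Plane trees and their closures -/

/-- Rooted plane trees in which every vertex has at most two children. -/
inductive PlaneTree : Type
  | leaf : PlaneTree
  | sub : PlaneTree → PlaneTree
  | node : PlaneTree → PlaneTree → PlaneTree
  deriving DecidableEq

namespace PlaneTree

/-- The vertices of a plane tree; `none` is the root of a tree that is not a single leaf. -/
def Vert : PlaneTree → Type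
  | leaf => Unit
  | sub t => Option (Vert t)
  | node a b => Option (Vert a ⊕ Vert b)

/-- The root. -/
def root : (t : PlaneTree) → t.Vert
  | leaf => ()
  | sub _ => none
  | node _ _ => none

/-- The leftmost leaf. -/
def first : (t : PlaneTree) → t.Vert
  | leaf => ()
  | sub t => some t.first
  | node a _ => some (Sum.inl a.first)

/-- The rightmost leaf. -/
def last : (t : PlaneTree) → t.Vert
  | leaf => ()
  | sub t => some t.last
  | node _ b => some (Sum.inr b.last)

/-- Adjacency in the plane tree together with the path that visits its leaves from left to right. -/
def Link : (t : PlaneTree) → t.Vert → t.Vert → Prop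
  | leaf, _, _ => False
  | sub _, none, none => False
  | sub t, none, some y => y = t.root
  | sub t, some x, none => x = t.root
  | sub t, some x, some y => t.Link x y
  | node _ _, none, none => False
  | node a _, none, some (Sum.inl y) => y = a.root
  | node _ b, none, some (Sum.inr y) => y = b.root
  | node a _, some (Sum.inl x), none => x = a.root
  | node _ b, some (Sum.inr x), none => x = b.root
  | node a _, some (Sum.inl x), some (Sum.inl y) => a.Link x y
  | node _ b, some (Sum.inr x), some (Sum.inr y) => b.Link x y
  | node a b, some (Sum.inl x), some (Sum.inr y) => x = a.last ∧ y = b.first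
  | node a b, some (Sum.inr x), some (Sum.inl y) => y = a.last ∧ x = b.first

theorem Link.symm : ∀ {t : PlaneTree} {x y : t.Vert}, t.Link x y → t.Link y x
  | sub _, none, some _, h => h
  | sub _, some _, none, h => h
  | sub t, some x, some y, h => Link.symm (t := t) (x := x) (y := y) h
  | node _ _, none, some (Sum.inl _), h => h
  | node _ _, none, some (Sum.inr _), h => h
  | node _ _, some (Sum.inl _), none, h => h
  | node _ _, some (Sum.inr _), none, h => h
  | node a _, some (Sum.inl x), some (Sum.inl y), h => Link.symm (t := a) (x := x) (y := y) h
  | node _ b, some (Sum.inr x), some (Sum.inr y), h => Link.symm (t := b) (x := x) (y := y) h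
  | node _ _, some (Sum.inl _), some (Sum.inr _), h => h
  | node _ _, some (Sum.inr _), some (Sum.inl _), h => h

theorem not_link_self : ∀ {t : PlaneTree} (x : t.Vert), ¬ t.Link x x
  | leaf, _ => id
  | sub _, none => id
  | sub t, some x => not_link_self (t := t) x
  | node _ _, none => id
  | node a _, some (Sum.inl x) => not_link_self (t := a) x
  | node _ b, some (Sum.inr x) => not_link_self (t := b) x

/-- The graph obtained by adding a vertex `none` that is joined to the root, to the leftmost leaf
and to the rightmost leaf. -/
def closure (t : PlaneTree) : SimpleGraph (Option t.Vert) where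
  Adj
    | none, none => False
    | none, some y => y = t.root ∨ y = t.first ∨ y = t.last
    | some x, none => x = t.root ∨ x = t.first ∨ x = t.last
    | some x, some y => t.Link x y
  symm := ⟨by rintro (_ | x) (_ | y) h <;> first | exact h | exact Link.symm h⟩
  loopless := ⟨by rintro (_ | x) h <;> first | exact h | exact not_link_self x h⟩

/-- The tree is a path. -/
def IsPath : PlaneTree → Prop
  | leaf => True
  | sub t => t.IsPath
  | node _ _ => False

/-- A tree that branches has a leaf on either side of the branching, whereas a path has only one.
With the next two facts, the added vertex of `closure` gets three distinct neighbors. -/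
theorem first_ne_last : ∀ {t : PlaneTree}, ¬ t.IsPath → t.first ≠ t.last
  | leaf, h => (h trivial).elim
  | sub t, h => fun h' => first_ne_last (t := t) h (Option.some.inj h')
  | node _ _, _ => fun h' => Sum.inl_ne_inr (Option.some.inj h')

theorem root_ne_first : ∀ {t : PlaneTree}, ¬ t.IsPath → t.root ≠ t.first
  | leaf, h => (h trivial).elim
  | sub _, _ => (Option.some_ne_none _).symm
  | node _ _, _ => (Option.some_ne_none _).symm

theorem root_ne_last : ∀ {t : PlaneTree}, ¬ t.IsPath → t.root ≠ t.last
  | leaf, h => (h trivial).elim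
  | sub _, _ => (Option.some_ne_none _).symm
  | node _ _, _ => (Option.some_ne_none _).symm

end PlaneTree

/-! ### Boundary colorings of plane trees -/

/-- `c` and `e` assign colors to the vertices and edges of the graph with adjacency relation `R` so
that adjacent or incident elements get distinct colors. -/
structure IsTotalColoring {X C : Type*} (R : X → X → Prop) (c : X → C) (e : X → X → C) : Prop where
  symm : ∀ x y, R x y → e x y = e y x
  vert : ∀ x y, R x y → c x ≠ c y
  inc : ∀ x y, R x y → e x y ≠ c x
  edge : ∀ x y z, R x y → R x z → y ≠ z → e x y ≠ e x z

/-- The color of a vertex and of a further edge that leaves it. -/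
abbrev Port : Type := Fin 4 × Fin 4

namespace PlaneTree

/-- `t.Colors p l q` holds if the tree, together with the path through its leaves, has a total
coloring that gives to the root and to a further edge at the root the colors `p`, to the leftmost
leaf and to a further edge there the colors `l`, and to the rightmost leaf and to a further edge
there the colors `q`. -/
inductive Colors : PlaneTree → Port → Port → Port → Prop
  | leaf {c x y z : Fin 4} : c ≠ x → c ≠ y → c ≠ z → x ≠ y → x ≠ z → y ≠ z →
      Colors leaf (c, x) (c, y) (c, z)
  | sub {t : PlaneTree} {p l q : Port} {x y : Fin 4} : Colors t p l q →
      x ≠ y → x ≠ p.1 → x ≠ p.2 → y ≠ p.2 → Colors (sub t) (x, y) l q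
  | node {a b : PlaneTree} {p p' l m m' q : Port} {x y : Fin 4} :
      Colors a p l m → Colors b p' m' q → m.1 ≠ m'.1 → m.2 = m'.2 →
      x ≠ y → p.2 ≠ p'.2 → x ≠ p.1 → x ≠ p.2 → y ≠ p.2 → x ≠ p'.1 → x ≠ p'.2 → y ≠ p'.2 →
      Colors (node a b) (x, y) l q

/-- The rules only compare colors for equality, so the names of the colors are irrelevant. This is
what permits normalizing the root port. -/
theorem Colors.perm {t : PlaneTree} {p l q : Port} (h : t.Colors p l q)
    (σ : Equiv.Perm (Fin 4)) : t.Colors (p.map σ σ) (l.map σ σ) (q.map σ σ) := by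
  induction h with
  | leaf => constructor <;> simpa
  | sub _ _ _ _ _ ih => refine Colors.sub ih ?_ ?_ ?_ ?_ <;> simpa
  | node _ _ _ _ _ _ _ _ _ _ _ _ ih₁ ih₂ =>
    refine Colors.node ih₁ ih₂ ?_ ?_ ?_ ?_ ?_ ?_ ?_ ?_ ?_ ?_ <;> simpa

/-- A port at the vertex `v`. -/
structure IsPort {X : Type*} (R : X → X → Prop) (c : X → Fin 4) (e : X → X → Fin 4) (v : X)
    (p : Port) : Prop where
  vert : c v = p.1
  inc : p.2 ≠ p.1
  edge : ∀ y, R v y → e v y ≠ p.2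

/-- Colorings of subtrees can be glued because subtrees interact with each other and with the new
root only through their ports. The last three clauses are needed for trees in which boundary
vertices coincide: there several outgoing edges share a vertex and must differ. -/
theorem Colors.exists_coloring {t : PlaneTree} {p l q : Port} (h : t.Colors p l q) :
    ∃ c e, IsTotalColoring t.Link c e ∧ IsPort t.Link c e t.root p ∧ IsPort t.Link c e t.first l ∧
      IsPort t.Link c e t.last q ∧ (t.root = t.first → p.2 ≠ l.2) ∧ (t.root = t.last → p.2 ≠ q.2) ∧
      (t.first = t.last → l.2 ≠ q.2) := by
  induction h with
  | @leaf c x y z h₁ h₂ h₃ h₄ h₅ h₆ =>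
    exact ⟨fun _ => c, fun _ _ => c, ⟨fun _ _ h => h.elim, fun _ _ h => h.elim,
      fun _ _ h => h.elim, fun _ _ _ h => h.elim⟩, ⟨rfl, h₁.symm, fun _ h => h.elim⟩,
      ⟨rfl, h₂.symm, fun _ h => h.elim⟩, ⟨rfl, h₃.symm, fun _ h => h.elim⟩, fun _ => h₄,
      fun _ => h₅, fun _ => h₆⟩
  | @sub t p l q x y _ h₁ h₂ h₃ h₄ ih =>
    obtain ⟨c, e, hc, hp, hl, hq, hpl, hpq, hlq⟩ := ih
    obtain ⟨hs, hv, hi, he⟩ := hc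
    obtain ⟨hp₁, hp₂, hp₃⟩ := hp
    obtain ⟨hl₁, hl₂, hl₃⟩ := hl
    obtain ⟨hq₁, hq₂, hq₃⟩ := hq
    refine ⟨fun v => Option.casesOn v x c, fun v w => Option.casesOn v p.2
      (fun v => Option.casesOn w p.2 (fun w => e v w)), ⟨?_, ?_, ?_, ?_⟩, ⟨rfl, h₁.symm, ?_⟩,
      ⟨by exact hl₁, hl₂, ?_⟩, ⟨by exact hq₁, hq₂, ?_⟩, ?_, ?_, ?_⟩
    · rintro (_ | v) (_ | w) h
      exacts [rfl, rfl, rfl, hs v w h]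
    · rintro (_ | v) (_ | w) h
      · exact h.elim
      · obtain rfl : w = _ := h
        exact fun h' => h₂ (h'.trans hp₁)
      · obtain rfl : v = _ := h
        exact fun h' => h₂ (h'.symm.trans hp₁)
      · exact hv v w h
    · rintro (_ | v) (_ | w) h
      · exact h.elim
      · exact h₃.symm
      · obtain rfl : v = _ := h
        exact fun h' => hp₂ (h'.trans hp₁)
      · exact hi v w h
    · rintro (_ | v) (_ | w) (_ | z) h h' hn
      · exact h.elim
      · exact h.elim
      · exact h'.elim
      · obtain rfl : w = _ := h
        obtain rfl : z = _ := h'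
        exact (hn rfl).elim
      · exact (hn rfl).elim
      · obtain rfl : v = _ := h
        exact (hp₃ z h').symm
      · obtain rfl : v = _ := h'
        exact hp₃ w h
      · exact he v w z h h' (fun h => hn (congrArg some h))
    · rintro (_ | v) h
      · exact h.elim
      · exact h₄.symm
    · rintro (_ | v) h
      · exact hpl (Eq.symm h)
      · exact hl₃ v h
    · rintro (_ | v) h
      · exact hpq (Eq.symm h)
      · exact hq₃ v h
    · exact fun h => (Option.some_ne_none _ h.symm).elim
    · exact fun h => (Option.some_ne_none _ h.symm).elim
    · exact fun h => hlq (Option.some.inj h)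
  | @node a b p p' l m m' q x y _ _ hm hm' h₁ h₂ h₃ h₄ h₅ h₆ h₇ h₈ ih₁ ih₂ =>
    obtain ⟨c, e, ⟨hs, hv, hi, he⟩, ⟨hp₁, hp₂, hp₃⟩, ⟨hl₁, hl₂, hl₃⟩, ⟨hq₁, hq₂, hq₃⟩,
      hpl, hpq, hlq⟩ := ih₁
    obtain ⟨c', e', ⟨hs', hv', hi', he'⟩, ⟨hp₁', hp₂', hp₃'⟩, ⟨hl₁', hl₂', hl₃'⟩,
      ⟨hq₁', hq₂', hq₃'⟩, hpl', hpq', hlq'⟩ := ih₂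
    -- Every pair across the two subtrees gets the color `m.2` of the joining path edge; the values
    -- at pairs that are not linked are irrelevant.
    refine ⟨fun v => Option.casesOn v x (Sum.elim c c'), fun v w => Option.casesOn v
      (Option.casesOn w x (Sum.elim (fun _ => p.2) (fun _ => p'.2)))
      (Sum.elim
        (fun v => Option.casesOn w p.2 (Sum.elim (fun w => e v w) (fun _ => m.2)))
        (fun v => Option.casesOn w p'.2 (Sum.elim (fun _ => m.2) (fun w => e' v w)))),
      ⟨?_, ?_, ?_, ?_⟩, ⟨rfl, h₁.symm, ?_⟩,
      ⟨by exact hl₁, hl₂, ?_⟩, ⟨by exact hq₁', hq₂', ?_⟩, ?_, ?_, ?_⟩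
    · rintro (_ | v | v) (_ | w | w) h
      exacts [rfl, rfl, rfl, rfl, hs v w h, rfl, rfl, rfl, hs' v w h]
    · rintro (_ | v | v) (_ | w | w) h
      · exact h.elim
      · obtain rfl : w = _ := h
        exact fun h' => h₃ (h'.trans hp₁)
      · obtain rfl : w = _ := h
        exact fun h' => h₆ (h'.trans hp₁')
      · obtain rfl : v = _ := h
        exact fun h' => h₃ (h'.symm.trans hp₁)
      · exact hv v w h
      · obtain ⟨rfl, rfl⟩ : v = _ ∧ w = _ := h
        exact fun h' => hm (hq₁.symm.trans (h'.trans hl₁'))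
      · obtain rfl : v = _ := h
        exact fun h' => h₆ (h'.symm.trans hp₁')
      · obtain ⟨rfl, rfl⟩ : w = _ ∧ v = _ := h
        exact fun h' => hm (hq₁.symm.trans (h'.symm.trans hl₁'))
      · exact hv' v w h
    · rintro (_ | v | v) (_ | w | w) h
      · exact h.elim
      · exact h₄.symm
      · exact h₇.symm
      · obtain rfl : v = _ := h
        exact fun h' => hp₂ (h'.trans hp₁)
      · exact hi v w h
      · obtain ⟨rfl, rfl⟩ : v = _ ∧ w = _ := h
        exact fun h' => hq₂ (h'.trans hq₁)
      · obtain rfl : v = _ := h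
        exact fun h' => hp₂' (h'.trans hp₁')
      · obtain ⟨rfl, rfl⟩ : w = _ ∧ v = _ := h
        exact fun h' => hl₂' (hm'.symm.trans (h'.trans hl₁'))
      · exact hi' v w h
    · rintro (_ | v | v) (_ | w | w) (_ | z | z) h h' hn
      -- `v` is the root
      iterate 3 exact h.elim
      · exact h'.elim
      · exact (hn (congrArg (some ∘ Sum.inl) ((show w = _ from h).trans (Eq.symm h')))).elim
      · exact h₂
      · exact h'.elim
      · exact h₂.symm
      · exact (hn (congrArg (some ∘ Sum.inr) ((show w = _ from h).trans (Eq.symm h')))).elim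
      -- `v` is in the left subtree
      · exact (hn rfl).elim
      · obtain rfl : v = _ := h
        exact (hp₃ z h').symm
      · obtain rfl : v = _ := h
        exact hpq h'.1
      · obtain rfl : v = _ := h'
        exact hp₃ w h
      · exact he v w z h h' (fun h => hn (congrArg (some ∘ Sum.inl) h))
      · obtain ⟨rfl, rfl⟩ : v = _ ∧ z = _ := h'
        exact hq₃ w h
      · obtain rfl : v = _ := h'
        exact fun h' => hpq h.1 h'.symm
      · obtain ⟨rfl, rfl⟩ : v = _ ∧ w = _ := h
        exact (hq₃ z h').symm
      · exact (hn (congrArg (some ∘ Sum.inr) (h.2.trans h'.2.symm))).elim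
      -- `v` is in the right subtree
      · exact (hn rfl).elim
      · obtain rfl : v = _ := h
        exact fun h => hpl' h'.2 (h.trans hm')
      · obtain rfl : v = _ := h
        exact (hp₃' z h').symm
      · obtain rfl : v = _ := h'
        exact fun h' => hpl' h.2 (h'.symm.trans hm')
      · exact (hn (congrArg (some ∘ Sum.inl) (h.1.trans h'.1.symm))).elim
      · obtain ⟨rfl, rfl⟩ : w = _ ∧ v = _ := h
        exact fun h => hl₃' z h' (h.symm.trans hm')
      · obtain rfl : v = _ := h'
        exact hp₃' w h
      · obtain ⟨rfl, rfl⟩ : z = _ ∧ v = _ := h'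
        exact fun h' => hl₃' w h (h'.trans hm')
      · exact he' v w z h h' (fun h => hn (congrArg (some ∘ Sum.inr) h))
    · rintro (_ | v | v) h
      exacts [h.elim, h₅.symm, h₈.symm]
    · rintro (_ | v | v) h
      exacts [hpl (Eq.symm h), hl₃ v h, fun h' => hlq h.1 h'.symm]
    · rintro (_ | v | v) h
      exacts [hpq' (Eq.symm h), fun h' => hlq' h.2.symm (hm' ▸ h'), hq₃' v h]
    · exact fun h => (Option.some_ne_none _ h.symm).elim
    · exact fun h => (Option.some_ne_none _ h.symm).elim
    · exact fun h => (Sum.inl_ne_inr (Option.some.inj h)).elim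

end PlaneTree

namespace PlaneTree

theorem Colors.exists_closure_coloring {t : PlaneTree} {p l q : Port} (h : t.Colors p l q)
    (ht : ¬ t.IsPath) {x : Fin 4} (hp : x ≠ p.1) (hp' : x ≠ p.2) (hl : x ≠ l.1) (hl' : x ≠ l.2)
    (hq : x ≠ q.1) (hq' : x ≠ q.2) (hpl : p.2 ≠ l.2) (hpq : p.2 ≠ q.2) (hlq : l.2 ≠ q.2) :
    ∃ (c : Option t.Vert → Fin 4) (e : Option t.Vert → Option t.Vert → Fin 4),
      IsTotalColoring t.closure.Adj c e := by
  classical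
  obtain ⟨c, e, ⟨hs, hv, hi, he⟩, ⟨hp₁, hp₂, hp₃⟩, ⟨hl₁, hl₂, hl₃⟩, ⟨hq₁, hq₂, hq₃⟩, -⟩ :=
    h.exists_coloring
  have h₁ := root_ne_first ht
  have h₂ := root_ne_last ht
  have h₃ := first_ne_last ht
  -- The colors of the edges to the added vertex. The default `q.2` is meant for the last leaf; the
  -- three cases do not clash because the tree is not a path.
  set g : t.Vert → Fin 4 := fun v => if v = t.root then p.2 else if v = t.first then l.2 else q.2
    with hg
  have g₁ : g t.root = p.2 := by simp [hg]
  have g₂ : g t.first = l.2 := by simp [hg, h₁.symm]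
  have g₃ : g t.last = q.2 := by simp [hg, h₂.symm, h₃.symm]
  clear_value g
  refine ⟨fun v => v.elim x c, fun v w => v.elim (w.elim x g) (fun v => w.elim (g v) (e v)),
    ?_, ?_, ?_, ?_⟩
  · rintro (_ | v) (_ | w) h
    exacts [rfl, rfl, rfl, hs v w h]
  · rintro (_ | v) (_ | w) h
    · exact h.elim
    · obtain rfl | rfl | rfl : w = _ ∨ w = _ ∨ w = _ := h
      exacts [fun h' => hp (h'.trans hp₁), fun h' => hl (h'.trans hl₁), fun h' => hq (h'.trans hq₁)]
    · obtain rfl | rfl | rfl : v = _ ∨ v = _ ∨ v = _ := h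
      exacts [fun h' => hp (h'.symm.trans hp₁), fun h' => hl (h'.symm.trans hl₁),
        fun h' => hq (h'.symm.trans hq₁)]
    · exact hv v w h
  · rintro (_ | v) (_ | w) h
    · exact h.elim
    · obtain rfl | rfl | rfl : w = _ ∨ w = _ ∨ w = _ := h
      exacts [fun h' => hp' (h'.symm.trans g₁), fun h' => hl' (h'.symm.trans g₂),
        fun h' => hq' (h'.symm.trans g₃)]
    · obtain rfl | rfl | rfl : v = _ ∨ v = _ ∨ v = _ := h
      exacts [fun h' => hp₂ (g₁.symm.trans (h'.trans hp₁)),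
        fun h' => hl₂ (g₂.symm.trans (h'.trans hl₁)), fun h' => hq₂ (g₃.symm.trans (h'.trans hq₁))]
    · exact hi v w h
  · have key : ∀ v, (v = t.root ∨ v = t.first ∨ v = t.last) → ∀ w, t.Link v w → e v w ≠ g v := by
      rintro v (rfl | rfl | rfl) w hw
      exacts [g₁ ▸ hp₃ w hw, g₂ ▸ hl₃ w hw, g₃ ▸ hq₃ w hw]
    rintro (_ | v) (_ | w) (_ | z) h h' hn
    · exact h.elim
    · exact h.elim
    · exact h'.elim
    · have hwz : w ≠ z := fun h => hn (congrArg some h)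
      obtain rfl | rfl | rfl : w = _ ∨ w = _ ∨ w = _ := h <;>
      obtain rfl | rfl | rfl : z = _ ∨ z = _ ∨ z = _ := h' <;>
      first
        | exact (hwz rfl).elim
        | simpa [g₁, g₂, g₃] using ‹_›
        | simpa [g₁, g₂, g₃] using Ne.symm ‹_›
    · exact (hn rfl).elim
    · exact (key v h z h').symm
    · exact key v h' w h
    · exact he v w z h h' (fun h => hn (congrArg some h))

end PlaneTree

/-! ### From total colorings to the total chromatic number -/

theorem IsTotalColoring.comp {X Y C : Type*} {R : X → X → Prop} {S : Y → Y → Prop} {c : Y → C}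
    {e : Y → Y → C} (h : IsTotalColoring S c e) {f : X → Y} (hf : Function.Injective f)
    (hR : ∀ x y, R x y → S (f x) (f y)) :
    IsTotalColoring R (fun x => c (f x)) (fun x y => e (f x) (f y)) where
  symm x y hxy := h.symm _ _ (hR x y hxy)
  vert x y hxy := h.vert _ _ (hR x y hxy)
  inc x y hxy := h.inc _ _ (hR x y hxy)
  edge x y z hxy hxz hyz := h.edge _ _ _ (hR x y hxy) (hR x z hxz) (hf.ne hyz)

theorem IsTotalColoring.colorable {V : Type*} {G : SimpleGraph V} {n : ℕ} {c : V → Fin n}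
    {e : V → V → Fin n} (h : IsTotalColoring G.Adj c e) : (totalGraph G).Colorable n := by
  classical
  obtain ⟨g, hg⟩ : ∃ g : Sym2 V → Fin n, ∀ x y, G.Adj x y → g s(x, y) = e x y := by
    -- A function on all of `Sym2 V` needs a value off the edges. The color of some vertex serves;
    -- without vertices there may be no color at all.
    rcases isEmpty_or_nonempty V with hV | ⟨⟨v⟩⟩
    · exact ⟨fun s => (hV.false s.out.1).elim, fun x => (hV.false x).elim⟩
    · refine ⟨Sym2.lift ⟨fun x y => if G.Adj x y then e x y else c v, fun x y => ?_⟩,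
        fun x y hxy => by simp [hxy]⟩
      by_cases hxy : G.Adj x y
      · simp [hxy, hxy.symm, h.symm x y hxy]
      · simp [hxy, G.adj_comm y x]
  have hve : ∀ (u : V) (s : G.edgeSet), u ∈ (s : Sym2 V) → c u ≠ g s := by
    rintro u ⟨s, hs⟩ hu
    obtain ⟨w, rfl⟩ := Sym2.mem_iff_exists.1 hu
    rw [hg u w hs]
    exact (h.inc u w hs).symm
  have hee : ∀ s s' : G.edgeSet, s ≠ s' → ∀ v, v ∈ (s : Sym2 V) → v ∈ (s' : Sym2 V) →
      g s ≠ g s' := by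
    rintro ⟨s, hs⟩ ⟨s', hs'⟩ hn v hv hv'
    obtain ⟨w, rfl⟩ := Sym2.mem_iff_exists.1 hv
    obtain ⟨w', rfl⟩ := Sym2.mem_iff_exists.1 hv'
    rw [hg v w hs, hg v w' hs']
    refine h.edge v w w' hs hs' ?_
    rintro rfl
    exact hn rfl
  refine ⟨SimpleGraph.Coloring.mk (Sum.elim c fun s => g s) ?_⟩
  rintro (u | s) (v | s') ⟨hn, huv | huv⟩
  · exact h.vert u v huv
  · exact (h.vert v u huv).symm
  · exact hve u s' huv
  · exact huv.elim
  · exact huv.elim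
  · exact (hve v s huv).symm
  · obtain ⟨v, hv, hv'⟩ := huv
    exact hee s s' (fun h => hn (congrArg _ h)) v hv hv'
  · obtain ⟨v, hv, hv'⟩ := huv
    exact hee s s' (fun h => hn (congrArg _ h)) v hv' hv

/-- A vertex and three edges at it form a clique of size four in the total graph. -/
theorem not_colorable_totalGraph {V : Type*} {G : SimpleGraph V} {v x y z : V} (hx : G.Adj v x)
    (hy : G.Adj v y) (hz : G.Adj v z) (hxy : x ≠ y) (hxz : x ≠ z) (hyz : y ≠ z) :
    ¬ (totalGraph G).Colorable 3 := by
  rintro ⟨C⟩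
  have hv : ∀ w (hw : G.Adj v w), C (Sum.inl v) ≠ C (Sum.inr ⟨s(v, w), hw⟩) := fun w hw =>
    C.valid ⟨Sum.inl_ne_inr, Or.inl (Sym2.mem_mk_left v w)⟩
  have he : ∀ w w' (hw : G.Adj v w) (hw' : G.Adj v w'), w ≠ w' →
      C (Sum.inr ⟨s(v, w), hw⟩) ≠ C (Sum.inr ⟨s(v, w'), hw'⟩) := by
    intro w w' hw hw' hn
    refine C.valid ⟨fun h => hn ?_, Or.inl ⟨v, Sym2.mem_mk_left v w, Sym2.mem_mk_left v w'⟩⟩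
    exact Sym2.congr_right.1 (Subtype.ext_iff.1 (Sum.inr.inj h))
  have h₁ := hv x hx
  have h₂ := hv y hy
  have h₃ := hv z hz
  have h₄ := he x y hx hy hxy
  have h₅ := he x z hx hz hxz
  have h₆ := he y z hy hz hyz
  omega

theorem totalChromaticNumber_eq_four {V : Type*} {H : SimpleGraph V} {t : PlaneTree}
    (ht : ¬ t.IsPath) (f : H ≃g t.closure) {c : Option t.Vert → Fin 4}
    {e : Option t.Vert → Option t.Vert → Fin 4} (h : IsTotalColoring t.closure.Adj c e) :
    totalChromaticNumber H = 4 := by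
  refine SimpleGraph.chromaticNumber_eq_iff_colorable_not_colorable.2
    ⟨(h.comp f.injective fun x y => f.map_adj_iff.2).colorable, ?_⟩
  have hf : ∀ v, t.closure.Adj none (some v) → H.Adj (f.symm none) (f.symm (some v)) := fun v hv =>
    f.symm.map_adj_iff.2 hv
  refine not_colorable_totalGraph (hf t.root (Or.inl rfl)) (hf t.first (Or.inr (Or.inl rfl)))
    (hf t.last (Or.inr (Or.inr rfl))) ?_ ?_ ?_ <;> refine f.symm.injective.ne ?_
  · exact fun h => PlaneTree.root_ne_first ht (Option.some.inj h)
  · exact fun h => PlaneTree.root_ne_last ht (Option.some.inj h)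
  · exact fun h => PlaneTree.first_ne_last ht (Option.some.inj h)

/-! ### Branches of a tree -/

/-- The vertices beyond the dart `d` of a tree. -/
def SimpleGraph.Dart.beyond {V : Type*} {T : SimpleGraph V} (d : T.Dart) : Set V :=
  {w | T.dist w d.fst = T.dist w d.snd + 1}

namespace SimpleGraph.IsTree

variable {V : Type*} {T : SimpleGraph V}

/-- Prepending `v` to shortest paths from `x` and from `y` to `w` gives two paths from `v` to `w`.
They agree in a tree, hence so do their second vertices. -/
theorem eq_of_dist_lt (hT : T.IsTree) {v w x y : V} (hx : T.Adj v x) (hy : T.Adj v y)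
    (hwx : T.dist w v = T.dist w x + 1) (hwy : T.dist w v = T.dist w y + 1) : x = y := by
  obtain ⟨p, hp, hpl⟩ := (hT.connected x w).exists_path_of_dist
  obtain ⟨q, hq, hql⟩ := (hT.connected y w).exists_path_of_dist
  have hcons : ∀ {z : V} (r : T.Walk z w) (hz : T.Adj v z), r.IsPath → r.length = T.dist z w →
      T.dist w v = T.dist w z + 1 → (SimpleGraph.Walk.cons hz r).IsPath := by
    intro z r hz hr hrl hd
    refine SimpleGraph.Walk.isPath_of_length_eq_dist _ ?_
    rw [SimpleGraph.Walk.length_cons, hrl, T.dist_comm (u := v), hd, T.dist_comm]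
  have h := hT.existsUnique_path v w |>.unique (hcons p hx hp hpl hwx) (hcons q hy hq hql hwy)
  simpa using congrArg (fun r : T.Walk v w => r.getVert 1) h

theorem snd_mem_beyond (d : T.Dart) : d.snd ∈ d.beyond := by
  simp [SimpleGraph.Dart.beyond, SimpleGraph.dist_eq_one_iff_adj.2 d.adj.symm]

theorem fst_notMem_beyond (d : T.Dart) : d.fst ∉ d.beyond := by
  simp [SimpleGraph.Dart.beyond]

/-- Going on from a dart without turning back, one sees fewer vertices. -/
theorem beyond_subset (hT : T.IsTree) {d d' : T.Dart} (h : d'.fst = d.snd) (hn : d'.snd ≠ d.fst) :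
    d'.beyond ⊆ d.beyond := by
  intro w hw
  have hw : T.dist w d'.fst = T.dist w d'.snd + 1 := hw
  by_contra hw'
  have hw' : ¬ T.dist w d.fst = T.dist w d.snd + 1 := hw'
  -- The distances to `w` from the two ends of `d` differ by exactly one. If `w` is not beyond `d`,
  -- then both `d.fst` and `d'.snd` are neighbors of `d.snd` closer to `w`.
  have hd := hT.dist_eq_dist_add_one_of_adj w d.adj
  rw [h] at hw
  exact hn (hT.eq_of_dist_lt (h ▸ d'.adj) d.adj.symm hw (hd.resolve_left hw'))

theorem disjoint_beyond (hT : T.IsTree) {d d' : T.Dart} (h : d.fst = d'.fst) (hn : d ≠ d') :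
    Disjoint d.beyond d'.beyond := by
  refine Set.disjoint_left.2 fun w hw hw' => hn ?_
  have hw' : T.dist w d'.fst = T.dist w d'.snd + 1 := hw'
  have := hT.eq_of_dist_lt d.adj (h ▸ d'.adj) hw (h ▸ hw')
  exact SimpleGraph.Dart.ext _ _ (Prod.ext h this)

/-- The common vertex `d.snd` is lost, so the inclusion is strict. This count is the measure for the
recursion in `exists_parses`. -/
theorem ncard_beyond_lt [Finite V] (hT : T.IsTree) {d d' : T.Dart} (h : d'.fst = d.snd)
    (hn : d'.snd ≠ d.fst) : d'.beyond.ncard < d.beyond.ncard :=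
  Set.ncard_lt_ncard ⟨hT.beyond_subset h hn, fun h' =>
    fst_notMem_beyond d' (h' (h ▸ snd_mem_beyond d))⟩ (Set.toFinite _)

end SimpleGraph.IsTree

/-! ### The walk along the boundary of the embedded tree -/

namespace RotationSystem

variable {V : Type*} {T : SimpleGraph V} (R : RotationSystem T)

/-- `v` is the first leaf met on the walk that starts with the dart `d`. -/
inductive Meets : T.Dart → V → Prop
  | leaf {d : T.Dart} : IsLeaf T d.snd → Meets d d.snd
  | step {d : T.Dart} {v : V} : ¬ IsLeaf T d.snd → Meets (R.faceStep d) v → Meets d v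

theorem faceStep_fst (d : T.Dart) : (R.faceStep d).fst = d.snd :=
  R.fst_rot d.symm

theorem faceStep_injective : Function.Injective R.faceStep := fun _ _ h =>
  SimpleGraph.Dart.symm_involutive.injective (R.rot.injective h)

variable {R}

theorem Meets.iterate {d : T.Dart} {v : V} (h : R.Meets d v) : ∃ n : ℕ, 0 < n ∧
    (R.faceStep^[n] d).fst = v ∧ ∀ k : ℕ, 0 < k → k < n → ¬ IsLeaf T (R.faceStep^[k] d).fst := by
  induction h with
  | @leaf d h => exact ⟨1, one_pos, R.faceStep_fst d, fun k h₁ h₂ => by omega⟩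
  | @step d v h _ ih =>
    obtain ⟨n, -, hn, hk⟩ := ih
    refine ⟨n + 1, n.succ_pos, hn, fun k hk₀ hkn => ?_⟩
    obtain ⟨k, rfl⟩ := Nat.exists_eq_succ_of_ne_zero hk₀.ne'
    rcases Nat.eq_zero_or_pos k with rfl | hk₀
    · exact R.faceStep_fst d ▸ h
    · exact hk k hk₀ (Nat.lt_of_succ_lt_succ hkn)

theorem Meets.isLeaf {d : T.Dart} {v : V} (h : R.Meets d v) : IsLeaf T v := by
  induction h <;> assumption

theorem Meets.nextLeaf {d : T.Dart} {v : V} (h : R.Meets d v) (hd : IsLeaf T d.fst) :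
    R.NextLeaf d.fst v :=
  ⟨hd, h.isLeaf, d, rfl, h.iterate⟩

theorem _root_.IsLeaf.dart_eq {d d' : T.Dart} (hd : IsLeaf T d.fst) (h : d.fst = d'.fst) :
    d = d' :=
  SimpleGraph.Dart.ext _ _ (Prod.ext h (hd.unique d.adj (h ▸ d'.adj)))

theorem NextLeaf.right_unique {u v v' : V} (h : R.NextLeaf u v) (h' : R.NextLeaf u v') :
    v = v' := by
  obtain ⟨hu, hv, d, rfl, n, hn, rfl, hk⟩ := h
  obtain ⟨-, hv', d', hd', n', hn', rfl, hk'⟩ := h'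
  obtain rfl := hu.dart_eq hd'.symm
  rcases lt_trichotomy n n' with h | rfl | h
  · exact (hk' n hn h hv).elim
  · rfl
  · exact (hk n' hn' h hv').elim

/-- Only one dart leaves the leaf `v`, and the face step is injective, so the two walks can be
traced back from that dart in parallel. -/
theorem NextLeaf.left_unique {u u' v : V} (h : R.NextLeaf u v) (h' : R.NextLeaf u' v) :
    u = u' := by
  obtain ⟨hu, hv, d, rfl, n, hn, hnv, hk⟩ := h
  obtain ⟨hu', -, d', rfl, n', hn', hnv', hk'⟩ := h'
  have key : R.faceStep^[n] d = R.faceStep^[n'] d' :=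
    IsLeaf.dart_eq (hnv.symm ▸ hv) (hnv.trans hnv'.symm)
  -- Cancelling `n` steps places `d` on the walk from `d'` after `m` steps. As that walk meets no
  -- leaf in between, `m = 0`.
  have aux : ∀ {d d' : T.Dart} {n m : ℕ}, IsLeaf T d.fst →
      (∀ k : ℕ, 0 < k → k < n + m → ¬ IsLeaf T (R.faceStep^[k] d').fst) → 0 < n →
      R.faceStep^[n] d = R.faceStep^[n + m] d' → d.fst = d'.fst := by
    intro d d' n m hd hk hn h
    rw [Function.iterate_add_apply] at h
    obtain rfl := R.faceStep_injective.iterate n h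
    rcases Nat.eq_zero_or_pos m with rfl | hm
    · rfl
    · exact (hk m hm (by omega) hd).elim
  rcases le_total n n' with h | h
  · obtain ⟨m, rfl⟩ := Nat.exists_eq_add_of_le h
    exact aux hu hk' hn key
  · obtain ⟨m, rfl⟩ := Nat.exists_eq_add_of_le h
    exact (aux hu' hk hn' key.symm).symm

/-- The darts at a vertex form one finite cycle, so natural powers of `rot` reach them all. Once the
rotation is known to close up after one, two or three steps, this lists all neighbors in `T`. -/
theorem mem_of_rot_mem [Finite V] {s : Set T.Dart} {d : T.Dart} (hd : d ∈ s)
    (hs : ∀ d' ∈ s, R.rot d' ∈ s) {d' : T.Dart} (h : d.fst = d'.fst) : d' ∈ s := by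
  have : Finite T.Dart := by
    classical
    have := Fintype.ofFinite V
    exact Finite.of_injective (fun d : T.Dart => d.toProd) SimpleGraph.Dart.toProd_injective
  obtain ⟨n, rfl⟩ := (R.sameCycle d d' h).exists_nat_pow_eq
  clear h
  induction n with
  | zero => exact hd
  | succ n ih => rw [pow_succ', Equiv.Perm.mul_apply]; exact hs _ ih

end RotationSystem

/-! ### Reading a plane tree off an embedded tree -/

namespace RotationSystem

variable {V : Type*} {T : SimpleGraph V}

/-- `φ` identifies the plane tree `t` with the part of the embedded tree beyond the dart `d`, and its
links with the edges of `H` there. -/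
structure Parses (R : RotationSystem T) (H : SimpleGraph V) (d : T.Dart) (t : PlaneTree)
    (φ : t.Vert → V) : Prop where
  inj : Function.Injective φ
  mem : ∀ x, φ x ∈ d.beyond
  root : φ t.root = d.snd
  first : R.Meets d (φ t.first)
  last : IsLeaf T (φ t.last)
  -- After the last leaf the boundary walk leaves the branch through the reverse of `d`. This is
  -- what links the last leaf to the first leaf of the next branch.
  meets : ∃ d' : T.Dart, d'.fst = φ t.last ∧ ∀ v, R.Meets d.symm v → R.Meets d' v
  adj : ∀ x y, t.Link x y → H.Adj (φ x) (φ y)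
  nbr : ∀ x w, H.Adj (φ x) w → (∃ y, t.Link x y ∧ w = φ y) ∨ (x = t.root ∧ w = d.fst) ∨
    (x = t.first ∧ R.NextLeaf w (φ x)) ∨ (x = t.last ∧ R.NextLeaf (φ x) w)
  path : t.IsPath → ∀ x, IsLeaf T (φ x) → x = t.first

variable {R : RotationSystem T} {H : SimpleGraph V}

theorem parses_leaf (hH : ∀ u v, H.Adj u v ↔ T.Adj u v ∨ R.NextLeaf u v ∨ R.NextLeaf v u)
    {d : T.Dart} (hd : IsLeaf T d.snd) : R.Parses H d .leaf fun _ => d.snd where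
  inj _ _ _ := rfl
  mem _ := SimpleGraph.IsTree.snd_mem_beyond d
  root := rfl
  first := .leaf hd
  last := hd
  meets := ⟨d.symm, rfl, fun _ h => h⟩
  adj _ _ h := h.elim
  nbr x w h := by
    rcases (hH _ _).1 h with h | h | h
    · exact Or.inr (Or.inl ⟨rfl, hd.unique h d.adj.symm⟩)
    · exact Or.inr (Or.inr (Or.inr ⟨rfl, h⟩))
    · exact Or.inr (Or.inr (Or.inl ⟨rfl, h⟩))
  path _ _ _ := rfl

theorem not_isLeaf_of_dart_ne {d d' : T.Dart} (h : d'.fst = d.fst) (hn : d' ≠ d) :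
    ¬ IsLeaf T d.fst := fun hd => hn (hd.dart_eq h.symm).symm

/-- A boundary walk that arrives along the reverse of `d'` turns into `d`, and goes on since it is
not at a leaf. -/
theorem Meets.of_rot_eq {d d' : T.Dart} (h : R.rot d' = d) (hd : ¬ IsLeaf T d.fst) {v : V}
    (hv : R.Meets d v) : R.Meets d'.symm v := by
  subst h
  rw [R.fst_rot] at hd
  refine Meets.step hd ?_
  rw [faceStep, SimpleGraph.Dart.symm_symm]
  exact hv

theorem parses_sub [Finite V] (hT : T.IsTree)
    (hH : ∀ u v, H.Adj u v ↔ T.Adj u v ∨ R.NextLeaf u v ∨ R.NextLeaf v u)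
    {d d₁ : T.Dart} (hd₁ : R.rot d.symm = d₁) (hd : R.rot d₁ = d.symm) (hn : d₁ ≠ d.symm)
    {t : PlaneTree} {φ : t.Vert → V} (h : R.Parses H d₁ t φ) :
    R.Parses H d (.sub t) fun x => Option.casesOn x d.snd φ := by
  have hf : d₁.fst = d.snd := hd₁ ▸ R.fst_rot d.symm
  have hl : ¬ IsLeaf T d.snd := not_isLeaf_of_dart_ne (d := d.symm) hf hn
  have hsub : d₁.beyond ⊆ d.beyond := hT.beyond_subset hf fun h =>
    hn (SimpleGraph.Dart.ext _ _ (Prod.ext hf h))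
  have hnot : ∀ x, φ x ≠ d.snd := fun x hx =>
    SimpleGraph.IsTree.fst_notMem_beyond d₁ (hf ▸ hx ▸ h.mem x)
  refine ⟨?_, ?_, rfl, ?_, h.last, ?_, ?_, ?_, ?_⟩
  · rintro (_ | x) (_ | y) hxy
    · rfl
    · exact (hnot y hxy.symm).elim
    · exact (hnot x hxy).elim
    · exact congrArg some (h.inj hxy)
  · rintro (_ | x)
    exacts [SimpleGraph.IsTree.snd_mem_beyond d, hsub (h.mem x)]
  · refine Meets.step hl ?_
    rw [faceStep, hd₁]
    exact h.first
  · obtain ⟨d', hd', hm⟩ := h.meets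
    exact ⟨d', hd', fun v hv => hm v (hv.of_rot_eq hd hl)⟩
  · have hroot : H.Adj d.snd (φ t.root) := (hH _ _).2 (Or.inl (h.root ▸ hf ▸ d₁.adj))
    rintro (_ | x) (_ | y) hxy
    · exact hxy.elim
    · obtain rfl : y = _ := hxy
      exact hroot
    · obtain rfl : x = _ := hxy
      exact hroot.symm
    · exact h.adj x y hxy
  · rintro (_ | x) w hw
    · rcases (hH _ _).1 hw with hw | hw | hw
      · have := R.mem_of_rot_mem (s := {d.symm, d₁}) (Or.inl rfl)
          (by rintro _ (rfl | rfl); exacts [Or.inr hd₁, Or.inl hd]) (d' := ⟨(d.snd, w), hw⟩) rfl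
        rcases this with h' | h'
        · exact Or.inr (Or.inl ⟨rfl, congrArg (fun d : T.Dart => d.snd) h'⟩)
        · exact Or.inl ⟨some t.root, rfl,
            (congrArg (fun d : T.Dart => d.snd) h').trans h.root.symm⟩
      · exact (hl hw.1).elim
      · exact (hl hw.2.1).elim
    · rcases h.nbr x w hw with ⟨y, hy, rfl⟩ | ⟨rfl, rfl⟩ | ⟨rfl, hw⟩ | ⟨rfl, hw⟩
      · exact Or.inl ⟨some y, hy, rfl⟩
      · exact Or.inl ⟨none, rfl, hf⟩
      · exact Or.inr (Or.inr (Or.inl ⟨rfl, hw⟩))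
      · exact Or.inr (Or.inr (Or.inr ⟨rfl, hw⟩))
  · rintro ht (_ | x) hx
    · exact (hl hx).elim
    · exact congrArg some (h.path ht x hx)

theorem parses_node [Finite V] (hT : T.IsTree)
    (hH : ∀ u v, H.Adj u v ↔ T.Adj u v ∨ R.NextLeaf u v ∨ R.NextLeaf v u)
    {d d₁ d₂ : T.Dart} (hd₁ : R.rot d.symm = d₁) (hd₂ : R.rot d₁ = d₂) (hd : R.rot d₂ = d.symm)
    (hn₁ : d₁ ≠ d.symm) (hn₂ : d₂ ≠ d.symm) (hn : d₁ ≠ d₂)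
    {a b : PlaneTree} {φ : a.Vert → V} {ψ : b.Vert → V} (h₁ : R.Parses H d₁ a φ)
    (h₂ : R.Parses H d₂ b ψ) :
    R.Parses H d (.node a b) fun x => Option.casesOn x d.snd (Sum.elim φ ψ) := by
  have hf₁ : d₁.fst = d.snd := hd₁ ▸ R.fst_rot d.symm
  have hf₂ : d₂.fst = d.snd := hd₂ ▸ (R.fst_rot d₁).trans hf₁
  have hl : ¬ IsLeaf T d.snd := not_isLeaf_of_dart_ne (d := d.symm) hf₁ hn₁
  have hsub₁ : d₁.beyond ⊆ d.beyond := hT.beyond_subset hf₁ fun h =>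
    hn₁ (SimpleGraph.Dart.ext _ _ (Prod.ext hf₁ h))
  have hsub₂ : d₂.beyond ⊆ d.beyond := hT.beyond_subset hf₂ fun h =>
    hn₂ (SimpleGraph.Dart.ext _ _ (Prod.ext hf₂ h))
  have hnot₁ : ∀ x, φ x ≠ d.snd := fun x hx =>
    SimpleGraph.IsTree.fst_notMem_beyond d₁ (hf₁ ▸ hx ▸ h₁.mem x)
  have hnot₂ : ∀ x, ψ x ≠ d.snd := fun x hx =>
    SimpleGraph.IsTree.fst_notMem_beyond d₂ (hf₂ ▸ hx ▸ h₂.mem x)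
  have hdisj : ∀ x y, φ x ≠ ψ y := fun x y hxy =>
    Set.disjoint_left.1 (hT.disjoint_beyond (hf₁.trans hf₂.symm) hn) (h₁.mem x) (hxy ▸ h₂.mem y)
  have hnext : R.NextLeaf (φ a.last) (ψ b.first) := by
    obtain ⟨d', hd', hm⟩ := h₁.meets
    rw [← hd']
    refine (hm _ (Meets.of_rot_eq hd₂ (hf₂ ▸ hl) h₂.first)).nextLeaf (hd' ▸ h₁.last)
  refine ⟨?_, ?_, rfl, ?_, h₂.last, ?_, ?_, ?_, ?_⟩
  · rintro (_ | x | x) (_ | y | y) hxy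
    · rfl
    · exact (hnot₁ y hxy.symm).elim
    · exact (hnot₂ y hxy.symm).elim
    · exact (hnot₁ x hxy).elim
    · exact congrArg (some ∘ Sum.inl) (h₁.inj hxy)
    · exact (hdisj x y hxy).elim
    · exact (hnot₂ x hxy).elim
    · exact (hdisj y x hxy.symm).elim
    · exact congrArg (some ∘ Sum.inr) (h₂.inj hxy)
  · rintro (_ | x | x)
    exacts [SimpleGraph.IsTree.snd_mem_beyond d, hsub₁ (h₁.mem x), hsub₂ (h₂.mem x)]
  · refine Meets.step hl ?_
    rw [faceStep, hd₁]
    exact h₁.first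
  · obtain ⟨d', hd', hm⟩ := h₂.meets
    exact ⟨d', hd', fun v hv => hm v (hv.of_rot_eq hd hl)⟩
  · have hroot₁ : H.Adj d.snd (φ a.root) := (hH _ _).2 (Or.inl (h₁.root ▸ hf₁ ▸ d₁.adj))
    have hroot₂ : H.Adj d.snd (ψ b.root) := (hH _ _).2 (Or.inl (h₂.root ▸ hf₂ ▸ d₂.adj))
    have hmid : H.Adj (φ a.last) (ψ b.first) := (hH _ _).2 (Or.inr (Or.inl hnext))
    rintro (_ | x | x) (_ | y | y) hxy
    · exact hxy.elim
    · obtain rfl : y = _ := hxy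
      exact hroot₁
    · obtain rfl : y = _ := hxy
      exact hroot₂
    · obtain rfl : x = _ := hxy
      exact hroot₁.symm
    · exact h₁.adj x y hxy
    · obtain ⟨rfl, rfl⟩ : x = _ ∧ y = _ := hxy
      exact hmid
    · obtain rfl : x = _ := hxy
      exact hroot₂.symm
    · obtain ⟨rfl, rfl⟩ : y = _ ∧ x = _ := hxy
      exact hmid.symm
    · exact h₂.adj x y hxy
  · rintro (_ | x | x) w hw
    · rcases (hH _ _).1 hw with hw | hw | hw
      · have := R.mem_of_rot_mem (s := {d.symm, d₁, d₂}) (Or.inl rfl)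
          (by
            rintro _ (rfl | rfl | rfl)
            exacts [Or.inr (Or.inl hd₁), Or.inr (Or.inr hd₂), Or.inl hd])
          (d' := ⟨(d.snd, w), hw⟩) rfl
        rcases this with h' | h' | h'
        · exact Or.inr (Or.inl ⟨rfl, congrArg (fun d : T.Dart => d.snd) h'⟩)
        · exact Or.inl ⟨some (Sum.inl a.root), rfl,
            (congrArg (fun d : T.Dart => d.snd) h').trans h₁.root.symm⟩
        · exact Or.inl ⟨some (Sum.inr b.root), rfl,
            (congrArg (fun d : T.Dart => d.snd) h').trans h₂.root.symm⟩
      · exact (hl hw.1).elim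
      · exact (hl hw.2.1).elim
    · rcases h₁.nbr x w hw with ⟨y, hy, rfl⟩ | ⟨rfl, rfl⟩ | ⟨rfl, hw⟩ | ⟨rfl, hw⟩
      · exact Or.inl ⟨some (Sum.inl y), hy, rfl⟩
      · exact Or.inl ⟨none, rfl, hf₁⟩
      · exact Or.inr (Or.inr (Or.inl ⟨rfl, hw⟩))
      · exact Or.inl ⟨some (Sum.inr b.first), ⟨rfl, rfl⟩, hw.right_unique hnext⟩
    · rcases h₂.nbr x w hw with ⟨y, hy, rfl⟩ | ⟨rfl, rfl⟩ | ⟨rfl, hw⟩ | ⟨rfl, hw⟩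
      · exact Or.inl ⟨some (Sum.inr y), hy, rfl⟩
      · exact Or.inl ⟨none, rfl, hf₂⟩
      · exact Or.inl ⟨some (Sum.inl a.last), ⟨rfl, rfl⟩, hw.left_unique hnext⟩
      · exact Or.inr (Or.inr (Or.inr ⟨rfl, hw⟩))
  · exact fun ht => ht.elim

/-- The darts that follow `d.symm` in the rotation at `d.snd` are the children from left to right.
The degree bound leaves at most two, and each branch beyond a child is smaller. -/
theorem exists_parses [Fintype V] [DecidableRel H.Adj] (hT : T.IsTree)
    (hH : ∀ u v, H.Adj u v ↔ T.Adj u v ∨ R.NextLeaf u v ∨ R.NextLeaf v u)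
    (hdeg : H.maxDegree ≤ 3) (d : T.Dart) : ∃ t φ, R.Parses H d t φ := by
  classical
  induction hN : d.beyond.ncard using Nat.strong_induction_on generalizing d with
  | _ N ih =>
  subst hN
  have hf₁ : (R.rot d.symm).fst = d.snd := R.fst_rot d.symm
  have hf₂ : (R.rot (R.rot d.symm)).fst = d.snd := (R.fst_rot _).trans hf₁
  have hf₃ : (R.rot (R.rot (R.rot d.symm))).fst = d.snd := (R.fst_rot _).trans hf₂
  have hrec : ∀ d' : T.Dart, d'.fst = d.snd → d' ≠ d.symm → ∃ t φ, R.Parses H d' t φ :=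
    fun d' hf hn => ih _ (hT.ncard_beyond_lt hf fun h =>
      hn (SimpleGraph.Dart.ext _ _ (Prod.ext hf h))) d' rfl
  by_cases hn₁ : R.rot d.symm = d.symm
  · refine ⟨_, _, parses_leaf hH ⟨d.fst, d.adj.symm, fun w hw => ?_⟩⟩
    have := R.mem_of_rot_mem (s := {d.symm}) rfl (by rintro _ rfl; exact hn₁)
      (d' := ⟨(d.snd, w), hw⟩) rfl
    exact congrArg (fun d : T.Dart => d.snd) this
  obtain ⟨a, φ, ha⟩ := hrec _ hf₁ hn₁
  by_cases hn₂ : R.rot (R.rot d.symm) = d.symm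
  · exact ⟨_, _, parses_sub hT hH rfl hn₂ hn₁ ha⟩
  obtain ⟨b, ψ, hb⟩ := hrec _ hf₂ hn₂
  have hn : R.rot d.symm ≠ R.rot (R.rot d.symm) := fun h => hn₁ (R.rot.injective h).symm
  by_cases hn₃ : R.rot (R.rot (R.rot d.symm)) = d.symm
  · exact ⟨_, _, parses_node hT hH rfl rfl hn₃ hn₁ hn₂ hn ha hb⟩
  -- Otherwise `d.symm` and its first three successors are distinct, and `d.snd` has four neighbors
  -- in `H`.
  exfalso
  set d₁ := R.rot d.symm
  set d₂ := R.rot d₁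
  set d₃ := R.rot d₂
  have hadj : ∀ d' : T.Dart, d'.fst = d.snd → d'.snd ∈ H.neighborFinset d.snd := fun d' h => by
    rw [SimpleGraph.mem_neighborFinset]
    exact (hH _ _).2 (Or.inl (h ▸ d'.adj))
  have hinj : ∀ d' d'' : T.Dart, d'.fst = d.snd → d''.fst = d.snd → d' ≠ d'' → d'.snd ≠ d''.snd :=
    fun d' d'' h h' hn h'' => hn (SimpleGraph.Dart.ext _ _ (Prod.ext (h.trans h'.symm) h''))
  have hsub : ({d.fst, d₁.snd, d₂.snd, d₃.snd} : Finset V) ⊆ H.neighborFinset d.snd := by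
    intro w hw
    simp only [Finset.mem_insert, Finset.mem_singleton] at hw
    rcases hw with rfl | rfl | rfl | rfl
    exacts [hadj d.symm rfl, hadj _ hf₁, hadj _ hf₂, hadj _ hf₃]
  have hcard : ({d.fst, d₁.snd, d₂.snd, d₃.snd} : Finset V).card = 4 := by
    have h₁ := hinj d.symm d₁ rfl hf₁ (Ne.symm hn₁)
    have h₂ := hinj d.symm d₂ rfl hf₂ (Ne.symm hn₂)
    have h₃ := hinj d.symm d₃ rfl hf₃ (Ne.symm hn₃)
    have h₄ := hinj d₁ d₂ hf₁ hf₂ hn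
    have h₅ := hinj d₁ d₃ hf₁ hf₃ fun h => hn₂ (R.rot.injective h).symm
    have h₆ := hinj d₂ d₃ hf₂ hf₃ fun h => hn (R.rot.injective h)
    refine Finset.card_eq_succ.2 ⟨_, _, ?_, rfl, Finset.card_eq_three.2
      ⟨_, _, _, h₄, h₅, h₆, rfl⟩⟩
    simpa using ⟨h₁, h₂, h₃⟩
  have h₁ := Finset.card_le_card hsub
  rw [hcard, SimpleGraph.card_neighborFinset_eq_degree] at h₁
  exact absurd (h₁.trans (H.degree_le_maxDegree d.snd)) (by omega)

end RotationSystem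

/-- A leaf `r` plays the added vertex: its neighbors are the adjacent tree vertex, the next leaf and
the previous leaf, that is, the root, first and last leaf of what lies beyond `r`. -/
theorem IsHalin.exists_iso_closure {V : Type*} [Fintype V] {H : SimpleGraph V} [DecidableRel H.Adj]
    (hH : IsHalin H) (hdeg : H.maxDegree ≤ 3) :
    ∃ t : PlaneTree, ¬ t.IsPath ∧ Nonempty (H ≃g t.closure) := by
  obtain ⟨T, hT, hl, R, hH⟩ := hH
  obtain ⟨r, hr : IsLeaf T r⟩ := Set.nonempty_of_ncard_ne_zero (s := {v | IsLeaf T v}) (by omega)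
  obtain ⟨s, hs⟩ := hr.exists
  obtain ⟨t, φ, h⟩ := RotationSystem.exists_parses hT hH hdeg ⟨(r, s), hs⟩
  have hnr : ∀ x, φ x ≠ r := fun x hx => SimpleGraph.IsTree.fst_notMem_beyond _ (hx ▸ h.mem x)
  have hfirst : R.NextLeaf r (φ t.first) := h.first.nextLeaf hr
  have hlast : R.NextLeaf (φ t.last) r := by
    obtain ⟨d', hd', hm⟩ := h.meets
    rw [← hd']
    exact (hm r (.leaf (d := SimpleGraph.Dart.symm ⟨(r, s), hs⟩) hr)).nextLeaf (hd' ▸ h.last)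
  set f : Option t.Vert → V := fun x => x.elim r φ with hf
  have hinj : Function.Injective f := by
    rintro (_ | x) (_ | y) hxy
    exacts [rfl, (hnr y hxy.symm).elim, (hnr x hxy).elim, congrArg some (h.inj hxy)]
  have hadj : ∀ x y, t.closure.Adj x y → H.Adj (f x) (f y) := by
    have key : ∀ y, (y = t.root ∨ y = t.first ∨ y = t.last) → H.Adj r (φ y) := by
      rintro y (rfl | rfl | rfl)
      exacts [(hH _ _).2 (Or.inl (h.root ▸ hs)), (hH _ _).2 (Or.inr (Or.inl hfirst)),
        (hH _ _).2 (Or.inr (Or.inr hlast))]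
    rintro (_ | x) (_ | y) hxy
    exacts [hxy.elim, key y hxy, (key x hxy).symm, h.adj x y hxy]
  have hnbr : ∀ x w, H.Adj (f x) w → ∃ y, t.closure.Adj x y ∧ w = f y := by
    rintro (_ | x) w hw
    · rcases (hH _ _).1 hw with hw | hw | hw
      · exact ⟨some t.root, Or.inl rfl, (hr.unique hw hs).trans h.root.symm⟩
      · exact ⟨some t.first, Or.inr (Or.inl rfl), hw.right_unique hfirst⟩
      · exact ⟨some t.last, Or.inr (Or.inr rfl), hw.left_unique hlast⟩
    · rcases h.nbr x w hw with ⟨y, hy, rfl⟩ | ⟨rfl, rfl⟩ | ⟨rfl, hw⟩ | ⟨rfl, hw⟩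
      · exact ⟨some y, hy, rfl⟩
      · exact ⟨none, Or.inl rfl, rfl⟩
      · exact ⟨none, Or.inr (Or.inl rfl), hw.left_unique hfirst⟩
      · exact ⟨none, Or.inr (Or.inr rfl), hw.right_unique hlast⟩
  -- The image contains `r` and is closed under neighbors, and `T` is connected.
  have hsurj : Function.Surjective f := by
    intro w
    obtain ⟨p⟩ := hT.connected r w
    have key : ∀ {u w : V}, T.Walk u w → (∃ x, f x = u) → ∃ x, f x = w := by
      intro u w p
      induction p with
      | nil => exact id
      | cons huv _ ih =>
        rintro ⟨x, rfl⟩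
        obtain ⟨y, -, rfl⟩ := hnbr x _ ((hH _ _).2 (Or.inl huv))
        exact ih ⟨y, rfl⟩
    exact key p ⟨none, rfl⟩
  refine ⟨t, fun ht => ?_, ⟨(⟨Equiv.ofBijective f ⟨hinj, hsurj⟩, ?_⟩ : t.closure ≃g H).symm⟩⟩
  -- For a path the only leaves of `T` would be `r` and the far end, but there are at least three.
  · have hsub : {v | IsLeaf T v} ⊆ {r, φ t.first} := by
      intro v hv
      obtain ⟨_ | x, rfl⟩ := hsurj v
      · exact Or.inl rfl
      · exact Or.inr (congrArg φ (h.path ht x hv))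
    have := (Set.ncard_le_ncard hsub (Set.toFinite _)).trans (Set.ncard_insert_le _ _)
    rw [Set.ncard_singleton] at this
    omega
  · intro x y
    refine ⟨fun hxy => ?_, hadj x y⟩
    obtain ⟨z, hz, hyz⟩ := hnbr x _ hxy
    rwa [hinj hyz]

/-! ### Bit masks for sets of boundary colorings

The ports `(v, e)` with `v ≠ e` are numbered from `0` to `11`. A natural number, read as a `12 × 12` bit matrix, stands for
a set of pairs of ports: the pair with numbers `i` and `j` belongs to the set if bit `12 * i + j` is
set. -/

namespace PortMask

/-- The port with a given number. -/
def port (i : ℕ) : Port :=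
  (Fin.ofNat 4 (i / 3), (Fin.ofNat 4 (i / 3)).succAbove (Fin.ofNat 3 i))

/-- The bits of the first column. -/
def column : ℕ := 0x001001001001001001001001001001001001

/-- The union of a list of masks. -/
def union {α : Type*} (f : α → ℕ) (L : List α) : ℕ :=
  L.foldr (fun x r => Nat.lor (f x) r) 0

/-- The columns of a bit matrix, moved to the first column. -/
def columns (A : ℕ) : List ℕ :=
  (List.range 12).map fun p => Nat.land (Nat.shiftRight A p) column

/-- The Boolean product of the matrix with the given columns and a bit matrix. The recursor makes
this fast in the kernel. -/
noncomputable def dot (C : List ℕ) : ℕ → ℕ :=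
  List.rec (fun _ => 0)
    (fun c _ ih B => Nat.lor (Nat.mul c (Nat.land B 4095)) (ih (Nat.shiftRight B 12))) C

/-- Copy the row `m.1` to the row `m.2` for all `m` in the list. -/
def moveRows (L : List (ℕ × ℕ)) (A : ℕ) : ℕ :=
  union (fun m => Nat.shiftLeft (Nat.land (Nat.shiftRight A (Nat.mul 12 m.1)) 4095)
    (Nat.mul 12 m.2)) L

/-- Copy the column `m.1` to the column `m.2` for all `m` in the list. -/
def moveColumns (L : List (ℕ × ℕ)) (A : ℕ) : ℕ :=
  union (fun m => Nat.shiftLeft (Nat.land (Nat.shiftRight A m.1) column) m.2) L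

theorem testBit_union {α : Type*} {f : α → ℕ} {L : List α} {k : ℕ} :
    (union f L).testBit k = true ↔ ∃ x ∈ L, (f x).testBit k = true := by
  induction L with
  | nil => simp [union]
  | cons x L ih =>
    rw [union, List.foldr_cons, ← union]
    rw [show Nat.lor (f x) (union f L) = f x ||| union f L from rfl, Nat.testBit_or]
    simp [ih]

theorem dvd_of_testBit_column {k : ℕ} (h : column.testBit k = true) : 12 ∣ k := by
  have hk : k < 144 := by
    by_contra hk
    rw [Nat.testBit_lt_two_pow ((by decide +kernel : column < 2 ^ 144).trans_le
      (Nat.pow_le_pow_right two_pos (not_lt.1 hk)))] at h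
    exact Bool.false_ne_true h
  have key : ∀ k : Fin 144, column.testBit k = true → 12 ∣ (k : ℕ) := by decide +kernel
  exact key ⟨k, hk⟩ h

theorem testBit_land_column {A p k : ℕ}
    (h : (Nat.land (Nat.shiftRight A p) column).testBit k = true) :
    12 ∣ k ∧ A.testBit (p + k) = true := by
  change ((A >>> p) &&& column).testBit k = true at h
  rw [Nat.testBit_and, Bool.and_eq_true, Nat.testBit_shiftRight] at h
  exact ⟨dvd_of_testBit_column h.2, h.1⟩

theorem testBit_land_row {A p k : ℕ}
    (h : (Nat.land (Nat.shiftRight A p) 4095).testBit k = true) :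
    k < 12 ∧ A.testBit (p + k) = true := by
  change ((A >>> p) &&& (2 ^ 12 - 1)).testBit k = true at h
  rw [Nat.testBit_and, Bool.and_eq_true, Nat.testBit_shiftRight, Nat.testBit_two_pow_sub_one] at h
  exact ⟨of_decide_eq_true h.2, h.1⟩

/-- The product puts a copy of the row `r` into each row selected by `c`. The copies occupy disjoint
blocks of twelve bits, so no carries occur and integer multiplication computes an outer product. -/
theorem testBit_column_mul_row {r : ℕ} (hr : r < 2 ^ 12) {i j : ℕ} (hj : j < 12) {c : ℕ}
    (hc : ∀ k, c.testBit k = true → 12 ∣ k) (h : (c * r).testBit (12 * i + j) = true) :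
    c.testBit (12 * i) = true ∧ r.testBit j = true := by
  have key : ∀ c, (∀ k, c.testBit k = true → 12 ∣ k) → ∀ k, (c * r).testBit k =
      if k < 12 then ((c.testBit 0).toNat * r).testBit k else (c / 2 ^ 12 * r).testBit (k - 12) := by
    intro c hc k
    -- Among the lowest twelve bits of `c` only bit `0` can be set; peeling off this block drives
    -- the induction on `i`.
    have hmod : c % 2 ^ 12 = (c.testBit 0).toNat := by
      refine Nat.eq_of_testBit_eq fun k => ?_
      rw [Nat.testBit_mod_two_pow, Nat.testBit_bool_toNat]
      rcases Nat.eq_zero_or_pos k with rfl | hk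
      · simp
      · rw [decide_eq_false hk.ne', Bool.false_and, Bool.and_eq_false_iff, decide_eq_false_iff_not]
        by_contra! hk'
        have := Nat.le_of_dvd hk (hc k (Bool.not_eq_false _ ▸ hk'.2))
        omega
    have hlt : (c.testBit 0).toNat * r < 2 ^ 12 := by
      cases c.testBit 0
      · simp
      · simpa using hr
    rw [← Nat.testBit_two_pow_mul_add _ hlt, ← hmod, ← mul_assoc, ← add_mul, Nat.div_add_mod]
  rw [key c hc] at h
  induction i generalizing c with
  | zero =>
    rw [mul_zero, zero_add, if_pos hj] at h
    rw [mul_zero]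
    cases hb : c.testBit 0 <;> simp_all
  | succ i ih =>
    rw [if_neg (by omega), show 12 * (i + 1) + j - 12 = 12 * i + j by omega] at h
    have hc' : ∀ k, (c / 2 ^ 12).testBit k = true → 12 ∣ k := fun k hk => by
      rw [Nat.testBit_div_two_pow] at hk
      exact (Nat.dvd_add_left dvd_rfl).1 (hc _ hk)
    rw [key _ hc'] at h
    have := ih hc' h
    rwa [Nat.testBit_div_two_pow] at this

theorem testBit_dot {C : List ℕ} {B k : ℕ} (h : (dot C B).testBit k = true) :
    ∃ p c, C[p]? = some c ∧
      (c * Nat.land (Nat.shiftRight B (12 * p)) 4095).testBit k = true := by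
  induction C generalizing B with
  | nil =>
    change Nat.testBit 0 k = true at h
    simp at h
  | cons c C ih =>
    change (c * Nat.land B 4095 ||| dot C (Nat.shiftRight B 12)).testBit k = true at h
    rw [Nat.testBit_or, Bool.or_eq_true] at h
    rcases h with h | h
    · exact ⟨0, c, rfl, h⟩
    · obtain ⟨p, c, hc, h⟩ := ih h
      refine ⟨p + 1, c, hc, ?_⟩
      rwa [show 12 * (p + 1) = 12 + 12 * p by ring,
        show Nat.shiftRight B (12 + 12 * p) = Nat.shiftRight (Nat.shiftRight B 12) (12 * p) from
          Nat.shiftRight_add B 12 (12 * p)]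

/-- A Boolean product is the union over `p` of the outer products of column `p` of `A` with row `p`
of `B`. The converse is not needed, because masks serve only as lower bounds. -/
theorem testBit_dot_columns {A B i j : ℕ} (hj : j < 12)
    (h : (dot (columns A) B).testBit (12 * i + j) = true) :
    ∃ p < 12, A.testBit (12 * i + p) = true ∧ B.testBit (12 * p + j) = true := by
  obtain ⟨p, c, hc, h⟩ := testBit_dot h
  rw [columns, List.getElem?_map, Option.map_eq_some_iff] at hc
  obtain ⟨p', hp, rfl⟩ := hc
  obtain ⟨hp', rfl⟩ := List.getElem?_eq_some_iff.1 hp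
  rw [List.getElem_range] at h
  rw [List.length_range] at hp'
  have hr : Nat.land (Nat.shiftRight B (12 * p)) 4095 < 2 ^ 12 :=
    Nat.and_lt_two_pow _ (by norm_num)
  obtain ⟨h₁, h₂⟩ := testBit_column_mul_row hr hj (fun k hk => (testBit_land_column hk).1) h
  exact ⟨p, hp', add_comm p _ ▸ (testBit_land_column h₁).2, (testBit_land_row h₂).2⟩

theorem testBit_moveRows {L : List (ℕ × ℕ)} {A i j : ℕ} (hj : j < 12)
    (h : (moveRows L A).testBit (12 * i + j) = true) :
    ∃ m ∈ L, m.2 = i ∧ A.testBit (12 * m.1 + j) = true := by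
  obtain ⟨m, hm, h⟩ := testBit_union.1 h
  change ((Nat.land (Nat.shiftRight A (12 * m.1)) 4095) <<< (12 * m.2)).testBit _ = true at h
  rw [Nat.testBit_shiftLeft, Bool.and_eq_true, decide_eq_true_eq] at h
  obtain ⟨h₁, h₂⟩ := testBit_land_row h.2
  obtain rfl : m.2 = i := by omega
  exact ⟨m, hm, rfl, by simpa using h₂⟩

theorem testBit_moveColumns {L : List (ℕ × ℕ)} {A i j : ℕ} (hj : j < 12)
    (hL : ∀ m ∈ L, m.2 < 12) (h : (moveColumns L A).testBit (12 * i + j) = true) :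
    ∃ m ∈ L, m.2 = j ∧ A.testBit (12 * i + m.1) = true := by
  obtain ⟨m, hm, h⟩ := testBit_union.1 h
  change ((Nat.land (Nat.shiftRight A m.1) column) <<< m.2).testBit _ = true at h
  rw [Nat.testBit_shiftLeft, Bool.and_eq_true, decide_eq_true_eq] at h
  obtain ⟨h₁, h₂⟩ := testBit_land_column h.2
  have := hL m hm
  obtain rfl : m.2 = j := by omega
  exact ⟨m, hm, rfl, by rwa [add_tsub_cancel_right, add_comm] at h₂⟩

/-- The set of pairs of ports given by `A` is contained in `P`. -/
def Bounds (A : ℕ) (P : Port → Port → Prop) : Prop :=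
  ∀ i < 12, ∀ j < 12, A.testBit (12 * i + j) = true → P (port i) (port j)

theorem Bounds.lor {A B : ℕ} {P : Port → Port → Prop} (hA : Bounds A P) (hB : Bounds B P) :
    Bounds (Nat.lor A B) P := by
  intro i hi j hj h
  change (A ||| B).testBit _ = true at h
  rw [Nat.testBit_or, Bool.or_eq_true] at h
  exact h.elim (hA i hi j hj) (hB i hi j hj)

/-- The equation says that `B` is a subset of `A`. Such weakening lets finitely many masks serve
infinitely many trees. -/
theorem Bounds.of_land_eq {A B : ℕ} {P : Port → Port → Prop} (hA : Bounds A P)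
    (h : Nat.land B A = B) : Bounds B P := by
  intro i hi j hj hB
  rw [← show B &&& A = B from h, Nat.testBit_and, Bool.and_eq_true] at hB
  exact hA i hi j hj hB.2

theorem Bounds.mono {A : ℕ} {P Q : Port → Port → Prop} (hA : Bounds A P)
    (h : ∀ l q, P l q → Q l q) : Bounds A Q :=
  fun i hi j hj hij => h _ _ (hA i hi j hj hij)

theorem Bounds.dot {A B : ℕ} {P Q : Port → Port → Prop} (hA : Bounds A P) (hB : Bounds B Q) :
    Bounds (dot (columns A) B) fun l q => ∃ m, P l m ∧ Q m q := by
  intro i hi j hj h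
  obtain ⟨p, hp, h₁, h₂⟩ := testBit_dot_columns hj h
  exact ⟨port p, hA i hi p hp h₁, hB p hp j hj h₂⟩

/-- Apply the same map of ports to rows and columns. -/
def move (L : List (ℕ × ℕ)) (A : ℕ) : ℕ := moveColumns L (moveRows L A)

theorem Bounds.move {A : ℕ} {P Q : Port → Port → Prop} (hA : Bounds A P) {L : List (ℕ × ℕ)}
    (f : Port → Port) (hL : ∀ m ∈ L, m.1 < 12 ∧ m.2 < 12 ∧ port m.2 = f (port m.1))
    (h : ∀ l q, P l q → Q (f l) (f q)) : Bounds (move L A) Q := by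
  intro i hi j hj hij
  obtain ⟨m, hm, rfl, h₁⟩ := testBit_moveColumns hj (fun m hm => (hL m hm).2.1) hij
  obtain ⟨m', hm', rfl, h₂⟩ := testBit_moveRows (hL m hm).1 h₁
  rw [(hL m hm).2.2, (hL m' hm').2.2]
  exact h _ _ (hA _ (hL m' hm').1 _ (hL m hm).1 h₂)

theorem Bounds.moveRows {A : ℕ} {P Q : Port → Port → Prop} (hA : Bounds A P) {L : List (ℕ × ℕ)}
    {r : Port → Port → Prop} (hL : ∀ m ∈ L, m.1 < 12 ∧ r (port m.1) (port m.2))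
    (h : ∀ l l' q, r l l' → P l q → Q l' q) : Bounds (moveRows L A) Q := by
  intro i hi j hj hij
  obtain ⟨m, hm, rfl, h₁⟩ := testBit_moveRows hj hij
  exact h _ _ _ (hL m hm).2 (hA _ (hL m hm).1 j hj h₁)

/-- The effect on ports of a permutation of the colors with `0 ↦ 1`, `1 ↦ 2`. -/
def moves12 : List (ℕ × ℕ) := [(0, 4), (1, 3), (2, 5), (3, 7), (4, 6), (5, 8), (6, 0), (7, 1),
  (8, 2), (9, 10), (10, 11), (11, 9)]

/-- The effect on ports of a permutation of the colors with `0 ↦ 3`, `1 ↦ 2`. -/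
def moves32 : List (ℕ × ℕ) := [(0, 11), (1, 9), (2, 10), (3, 8), (4, 6), (5, 7), (6, 2), (7, 1),
  (8, 0), (9, 5), (10, 4), (11, 3)]

/-- The effect on ports of a permutation of the colors with `0 ↦ 1`, `1 ↦ 3`. -/
def moves13 : List (ℕ × ℕ) := [(0, 5), (1, 3), (2, 4), (3, 10), (4, 9), (5, 11), (6, 0), (7, 2),
  (8, 1), (9, 7), (10, 8), (11, 6)]

/-- The effect on ports of a permutation of the colors with `0 ↦ 2`, `1 ↦ 3`. -/
def moves23 : List (ℕ × ℕ) := [(0, 8), (1, 6), (2, 7), (3, 11), (4, 9), (5, 10), (6, 1), (7, 2),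
  (8, 0), (9, 4), (10, 5), (11, 3)]

/-- The pairs of ports with the same edge color and distinct vertex colors. -/
def joins : List (ℕ × ℕ) := [(3, 6), (3, 9), (6, 3), (6, 9), (9, 3), (9, 6), (0, 7), (0, 10),
  (7, 0), (7, 10), (10, 0), (10, 7), (1, 4), (1, 11), (4, 1), (4, 11), (11, 1), (11, 4), (2, 5),
  (2, 8), (5, 2), (5, 8), (8, 2), (8, 5)]

/-- From a mask for the root port `(0, 1)` to one for the root ports `(1, 2)` and `(3, 2)`. -/
def toTwo (A : ℕ) : ℕ := Nat.lor (move moves12 A) (move moves32 A)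

/-- From a mask for the root port `(0, 1)` to one for the root ports `(1, 3)` and `(2, 3)`. -/
def toThree (A : ℕ) : ℕ := Nat.lor (move moves13 A) (move moves23 A)

/-- `A` is a set of pairs of ports at the leftmost and rightmost leaf that occur in colorings
with the port `(0, 1)` at the root. -/
def Realizes (A : ℕ) (t : PlaneTree) : Prop := Bounds A fun l q => t.Colors (0, 1) l q

theorem bounds_move_of_perm {A : ℕ} {t : PlaneTree} (h : Realizes A t) (σ : Equiv.Perm (Fin 4))
    {L : List (ℕ × ℕ)}
    (hL : ∀ m ∈ L, m.1 < 12 ∧ m.2 < 12 ∧ port m.2 = (port m.1).map σ σ) :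
    Bounds (move L A) fun l q => t.Colors (σ 0, σ 1) l q :=
  h.move (fun p => p.map σ σ) hL fun _ _ hc => hc.perm σ

/-- Below a root with port `(0, 1)` the edges to children have colors `2` and `3`. A child reached
by the edge of color `2` has color `1` or `3`, whence two permutations; any with these values at `0`
and `1` would be sound. -/
theorem Realizes.toTwo {A : ℕ} {t : PlaneTree} (h : Realizes A t) :
    Bounds (toTwo A) fun l q => ∃ v, v ≠ 0 ∧ v ≠ 2 ∧ t.Colors (v, 2) l q :=
  ((bounds_move_of_perm h ⟨![1, 2, 0, 3], ![2, 0, 1, 3], by decide, by decide⟩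
      (L := moves12) (by decide)).mono fun _ _ h => ⟨1, by decide, by decide, h⟩).lor
    ((bounds_move_of_perm h ⟨![3, 2, 0, 1], ![2, 3, 1, 0], by decide, by decide⟩
      (L := moves32) (by decide)).mono fun _ _ h => ⟨3, by decide, by decide, h⟩)

theorem Realizes.toThree {A : ℕ} {t : PlaneTree} (h : Realizes A t) :
    Bounds (toThree A) fun l q => ∃ v, v ≠ 0 ∧ v ≠ 3 ∧ t.Colors (v, 3) l q :=
  ((bounds_move_of_perm h ⟨![1, 3, 0, 2], ![2, 0, 3, 1], by decide, by decide⟩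
      (L := moves13) (by decide)).mono fun _ _ h => ⟨1, by decide, by decide, h⟩).lor
    ((bounds_move_of_perm h ⟨![2, 3, 0, 1], ![2, 3, 0, 1], by decide, by decide⟩
      (L := moves23) (by decide)).mono fun _ _ h => ⟨2, by decide, by decide, h⟩)

/-- The path edge between two subtrees has one color seen from both ends, and its ends have distinct
colors. Absorbing this relation into the rows of the right factor turns gluing into a matrix
product. -/
theorem Bounds.joins {A : ℕ} {P : Port → Port → Prop} (h : Bounds A P) :
    Bounds (PortMask.moveRows joins A) fun m q => ∃ m', m.1 ≠ m'.1 ∧ m.2 = m'.2 ∧ P m' q :=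
  h.moveRows (r := fun m' m => m.1 ≠ m'.1 ∧ m.2 = m'.2) (by decide)
    fun m' _ _ hr hP => ⟨m', hr.1, hr.2, hP⟩

/-- The mask of `t.sub`, computed from the mask of `t`. -/
def subMask (A : ℕ) : ℕ := Nat.lor (toTwo A) (toThree A)

/-- A mask with the matrices and columns from which the masks of nodes are computed. -/
structure Entry where
  mask : ℕ
  leftTwo : List ℕ
  leftThree : List ℕ
  rightTwo : ℕ
  rightThree : ℕ

/-- The entry of a mask. -/
def entry (A : ℕ) : Entry :=
  ⟨A, columns (toTwo A), columns (toThree A), PortMask.moveRows joins (toTwo A),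
    PortMask.moveRows joins (toThree A)⟩

/-- The mask of `a.node b`, computed from the entries of `a` and `b`. -/
noncomputable def nodeMask (x y : Entry) : ℕ :=
  Nat.lor (dot x.leftTwo y.rightThree) (dot x.leftThree y.rightTwo)

theorem Realizes.sub {A : ℕ} {t : PlaneTree} (h : Realizes A t) : Realizes (subMask A) t.sub := by
  refine Bounds.lor (h.toTwo.mono ?_) (h.toThree.mono ?_)
  · rintro l q ⟨v, h₁, h₂, hc⟩
    exact hc.sub (by simp) h₁.symm (by simp) (by simp)
  · rintro l q ⟨v, h₁, h₂, hc⟩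
    exact hc.sub (by simp) h₁.symm (by simp) (by simp)

theorem Realizes.node {A B : ℕ} {a b : PlaneTree} (ha : Realizes A a) (hb : Realizes B b) :
    Realizes (nodeMask (entry A) (entry B)) (a.node b) := by
  refine Bounds.lor ((ha.toTwo.dot hb.toThree.joins).mono ?_)
    ((ha.toThree.dot hb.toTwo.joins).mono ?_)
  · rintro l q ⟨m, ⟨v, h₁, h₂, hc⟩, m', hm, hm', v', h₁', h₂', hc'⟩
    exact hc.node hc' hm hm' (by simp) (by simp) h₁.symm (by simp) (by simp) h₁'.symm
      (by simp) (by simp)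
  · rintro l q ⟨m, ⟨v, h₁, h₂, hc⟩, m', hm, hm', v', h₁', h₂', hc'⟩
    exact hc.node hc' hm hm' (by simp) (by simp) h₁.symm (by simp) (by simp) h₁'.symm
      (by simp) (by simp)

/-- The pairs of ports that together with the root port `(0, 1)` can be joined to a further
vertex. -/
def closing : List (ℕ × ℕ) := [(3, 2), (3, 5), (9, 2), (9, 5), (2, 3), (2, 9), (5, 3), (5, 9),
  (3, 1), (3, 4), (6, 1), (6, 4), (1, 3), (1, 6), (4, 3), (4, 6)]

/-- The mask contains a pair of ports that can be joined to a further vertex. -/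
def closable (A : ℕ) : Bool := closing.any fun m => A.testBit (12 * m.1 + m.2)

theorem Realizes.exists_closure_coloring {A : ℕ} {t : PlaneTree} (h : Realizes A t)
    (ht : ¬ t.IsPath) (hA : closable A = true) :
    ∃ (c : Option t.Vert → Fin 4) (e : Option t.Vert → Option t.Vert → Fin 4),
      IsTotalColoring t.closure.Adj c e := by
  obtain ⟨m, hm, hA⟩ := List.any_eq_true.1 hA
  -- Here `x` is the color of the added vertex, `2` or `3`. Its edge to the root has color `1`, and
  -- its edges to the two leaves share out the remaining two colors.
  have key : ∀ m ∈ closing, m.1 < 12 ∧ m.2 < 12 ∧ ∃ x : Fin 4, x ≠ 0 ∧ x ≠ 1 ∧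
      x ≠ (port m.1).1 ∧ x ≠ (port m.1).2 ∧ x ≠ (port m.2).1 ∧ x ≠ (port m.2).2 ∧
      1 ≠ (port m.1).2 ∧ 1 ≠ (port m.2).2 ∧ (port m.1).2 ≠ (port m.2).2 := by decide
  obtain ⟨hm₁, hm₂, x, h₁, h₂, h₃, h₄, h₅, h₆, h₇, h₈, h₉⟩ := key m hm
  exact (h _ hm₁ _ hm₂ hA).exists_closure_coloring ht h₁ h₂ h₃ h₄ h₅ h₆ h₇ h₈ h₉

/-- The pairs of ports in the colorings of a single leaf. -/
def leafMask : ℕ := 2 ^ (12 * 1 + 2) + 2 ^ (12 * 2 + 1)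

theorem realizes_leaf : Realizes leafMask .leaf := by
  have key : ∀ i < 12, ∀ j < 12, leafMask.testBit (12 * i + j) = true →
      i = 1 ∧ j = 2 ∨ i = 2 ∧ j = 1 := by decide +kernel
  intro i hi j hj h
  obtain ⟨rfl, rfl⟩ | ⟨rfl, rfl⟩ := key i hi j hj h
  · exact .leaf (by decide) (by decide) (by decide) (by decide) (by decide) (by decide)
  · exact .leaf (by decide) (by decide) (by decide) (by decide) (by decide) (by decide)

end PortMask

/-! ### Recognizing the five excluded graphs -/

namespace PlaneTree

instance decidableEqVert : (t : PlaneTree) → DecidableEq t.Vert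
  | leaf => inferInstanceAs (DecidableEq Unit)
  | sub t =>
    haveI := decidableEqVert t
    inferInstanceAs (DecidableEq (Option t.Vert))
  | node a b =>
    haveI := decidableEqVert a
    haveI := decidableEqVert b
    inferInstanceAs (DecidableEq (Option (a.Vert ⊕ b.Vert)))

instance decidableLink : (t : PlaneTree) → (x y : t.Vert) → Decidable (t.Link x y)
  | leaf, _, _ => instDecidableFalse
  | sub _, none, none => instDecidableFalse
  | sub t, none, some y => inferInstanceAs (Decidable (y = t.root))
  | sub t, some x, none => inferInstanceAs (Decidable (x = t.root))
  | sub t, some x, some y => decidableLink t x y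
  | node _ _, none, none => instDecidableFalse
  | node a _, none, some (Sum.inl y) => inferInstanceAs (Decidable (y = a.root))
  | node _ b, none, some (Sum.inr y) => inferInstanceAs (Decidable (y = b.root))
  | node a _, some (Sum.inl x), none => inferInstanceAs (Decidable (x = a.root))
  | node _ b, some (Sum.inr x), none => inferInstanceAs (Decidable (x = b.root))
  | node a _, some (Sum.inl x), some (Sum.inl y) => decidableLink a x y
  | node _ b, some (Sum.inr x), some (Sum.inr y) => decidableLink b x y
  | node a b, some (Sum.inl x), some (Sum.inr y) =>
    inferInstanceAs (Decidable (x = a.last ∧ y = b.first))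
  | node a b, some (Sum.inr x), some (Sum.inl y) =>
    inferInstanceAs (Decidable (y = a.last ∧ x = b.first))

instance (t : PlaneTree) : DecidableRel t.closure.Adj
  | none, none => instDecidableFalse
  | none, some y => inferInstanceAs (Decidable (y = t.root ∨ y = t.first ∨ y = t.last))
  | some x, none => inferInstanceAs (Decidable (x = t.root ∨ x = t.first ∨ x = t.last))
  | some x, some y => inferInstanceAs (Decidable (t.Link x y))

/-- The vertices in preorder. -/
def verts : (t : PlaneTree) → List t.Vert
  | leaf => [()]
  | sub t => none :: t.verts.map some
  | node a b => none :: (a.verts.map (some ∘ Sum.inl) ++ b.verts.map (some ∘ Sum.inr))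

theorem mem_verts : ∀ (t : PlaneTree) (x : t.Vert), x ∈ t.verts
  | leaf, _ => List.mem_cons_self
  | sub _, none => List.mem_cons_self
  | sub t, some x => List.mem_cons_of_mem _ (List.mem_map_of_mem (mem_verts t x))
  | node _ _, none => List.mem_cons_self
  | node a _, some (Sum.inl x) =>
    List.mem_cons_of_mem _ (List.mem_append_left _ (List.mem_map_of_mem (mem_verts a x)))
  | node _ b, some (Sum.inr x) =>
    List.mem_cons_of_mem _ (List.mem_append_right _ (List.mem_map_of_mem (mem_verts b x)))

/-- The vertices of `t.closure`. -/
def closureVerts (t : PlaneTree) : List (Option t.Vert) := none :: t.verts.map some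

theorem mem_closureVerts (t : PlaneTree) : ∀ x, x ∈ t.closureVerts
  | none => List.mem_cons_self
  | some x => List.mem_cons_of_mem _ (List.mem_map_of_mem (t.mem_verts x))

/-- The labels `L` of the vertices of `t.closure` in preorder define an isomorphism to the graph on
`{0, …, n - 1}` in which `i` and `j` are adjacent if bit `n * i + j` of `M` is set. -/
def IsLabeling (n M : ℕ) (t : PlaneTree) (L : List ℕ) : Prop :=
  L.length = t.closureVerts.length ∧ (∀ i ∈ L, i < n) ∧ (∀ i < n, i ∈ L) ∧
    ∀ p ∈ t.closureVerts.zip L, ∀ q ∈ t.closureVerts.zip L,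
      (p.2 = q.2 ↔ p.1 = q.1) ∧ (t.closure.Adj p.1 q.1 ↔ M.testBit (n * p.2 + q.2) = true)

instance (n M : ℕ) (t : PlaneTree) (L : List ℕ) : Decidable (IsLabeling n M t L) := by
  unfold IsLabeling
  infer_instance

/-- Listing vertices against labels and storing adjacency in one number turns an isomorphism into a
finite check by evaluation. -/
theorem IsLabeling.nonempty_iso {n M : ℕ} {G : SimpleGraph (Fin n)}
    (hM : ∀ i j : Fin n, G.Adj i j ↔ M.testBit (n * i + j) = true) {t : PlaneTree} {L : List ℕ}
    (h : IsLabeling n M t L) : Nonempty (t.closure ≃g G) := by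
  obtain ⟨hlen, hlt, hsurj, hadj⟩ := h
  have hex : ∀ x, ∃ i : Fin n, (x, (i : ℕ)) ∈ t.closureVerts.zip L := by
    intro x
    obtain ⟨k, hk, hx⟩ := List.getElem_of_mem (t.mem_closureVerts x)
    refine ⟨⟨L[k], hlt _ (List.getElem_mem (hlen ▸ hk))⟩, List.mem_iff_getElem.2 ⟨k, ?_, ?_⟩⟩
    · rw [List.length_zip, hlen, min_self]
      exact hk
    · rw [List.getElem_zip, hx]
  choose f hf using hex
  have hinj : Function.Injective f := fun x y hxy =>
    (hadj _ (hf x) _ (hf y)).1.1 (congrArg Fin.val hxy)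
  have hsurj : Function.Surjective f := by
    intro i
    obtain ⟨k, hk, hi⟩ := List.getElem_of_mem (hsurj i i.2)
    have hk' : k < t.closureVerts.length := hlen ▸ hk
    have hmem : (t.closureVerts[k], (i : ℕ)) ∈ t.closureVerts.zip L :=
      List.mem_iff_getElem.2 ⟨k, by rw [List.length_zip, hlen, min_self]; exact hk',
        by rw [List.getElem_zip, hi]⟩
    exact ⟨t.closureVerts[k], Fin.ext ((hadj _ (hf _) _ hmem).1.2 rfl)⟩
  refine ⟨⟨Equiv.ofBijective f ⟨hinj, hsurj⟩, fun {x y} => ?_⟩⟩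
  exact (hM _ _).trans (hadj _ (hf x) _ (hf y)).2.symm

end PlaneTree

instance (n : ℕ) (E : List (Fin n × Fin n)) : DecidableRel (graphOfEdges n E).Adj := fun a b =>
  inferInstanceAs (Decidable (a ≠ b ∧ ((a, b) ∈ E ∨ (b, a) ∈ E)))

instance : DecidableRel halinK4.Adj := inferInstanceAs (DecidableRel (⊤ : SimpleGraph (Fin 4)).Adj)

instance : DecidableRel halinH3.Adj := inferInstanceAs (DecidableRel (graphOfEdges _ _).Adj)

instance : DecidableRel halinH4.Adj := inferInstanceAs (DecidableRel (graphOfEdges _ _).Adj)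

instance : DecidableRel halinH5.Adj := inferInstanceAs (DecidableRel (graphOfEdges _ _).Adj)

instance : DecidableRel halinH8.Adj := inferInstanceAs (DecidableRel (graphOfEdges _ _).Adj)

open PlaneTree

/-- The plane trees `t` for which `t.closure` is `halinK4`, with the label of the added vertex and
the labels of the vertices in preorder. -/
def labelsK4 : List (PlaneTree × List ℕ) :=
  [(node leaf leaf, [0, 3, 1, 2])]

/-- The plane trees `t` for which `t.closure` is `halinH3`, with the label of the added vertex and
the labels of the vertices in preorder. -/
def labelsH3 : List (PlaneTree × List ℕ) :=
  [(node (node leaf leaf) (sub leaf), [1, 5, 6, 2, 3, 4, 0]),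
   (node (node leaf (sub leaf)) leaf, [2, 6, 5, 1, 4, 0, 3]),
   (node (node (sub leaf) leaf) leaf, [3, 6, 5, 4, 0, 1, 2]),
   (node leaf (node leaf (sub leaf)), [3, 6, 2, 5, 1, 4, 0]),
   (node leaf (node (sub leaf) leaf), [2, 6, 3, 5, 4, 0, 1]),
   (node (sub leaf) (node leaf leaf), [1, 5, 4, 0, 6, 3, 2]),
   (sub (node (node leaf leaf) leaf), [0, 4, 5, 6, 3, 2, 1]),
   (sub (node leaf (node leaf leaf)), [0, 4, 5, 1, 6, 2, 3])]

/-- The plane trees `t` for which `t.closure` is `halinH4`, with the label of the added vertex and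
the labels of the vertices in preorder. -/
def labelsH4 : List (PlaneTree × List ℕ) :=
  [(node (node (node (node leaf leaf) leaf) leaf) leaf, [0, 6, 7, 8, 9, 5, 4, 3, 2, 1]),
   (node (node leaf (node leaf (node leaf leaf))) leaf, [1, 6, 7, 2, 8, 3, 9, 4, 5, 0]),
   (node (node leaf (node leaf leaf)) (node leaf leaf), [2, 7, 8, 3, 9, 4, 5, 6, 0, 1]),
   (node (node leaf leaf) (node (node leaf leaf) leaf), [2, 7, 6, 1, 0, 8, 9, 5, 4, 3]),
   (node leaf (node (node (node leaf leaf) leaf) leaf), [1, 6, 0, 7, 8, 9, 5, 4, 3, 2]),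
   (node leaf (node leaf (node leaf (node leaf leaf))), [0, 6, 1, 7, 2, 8, 3, 9, 4, 5])]

/-- The plane trees `t` for which `t.closure` is `halinH5`, with the label of the added vertex and
the labels of the vertices in preorder. -/
def labelsH5 : List (PlaneTree × List ℕ) :=
  [
   (node (node (node (node (node leaf leaf) leaf) leaf) leaf) leaf, [0, 7, 8, 9, 10, 11, 6, 5, 4,
     3, 2, 1]),
   (node (node leaf (node leaf (node leaf (node leaf leaf)))) leaf, [1, 7, 8, 2, 9, 3, 10, 4, 11,
     5, 6, 0]),
   (node (node leaf (node leaf (node leaf leaf))) (node leaf leaf), [2, 8, 9, 3, 10, 4, 11, 5, 6,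
     7, 0, 1]),
   (node (node leaf (node leaf leaf)) (node (node leaf leaf) leaf), [3, 9, 10, 4, 11, 5, 6, 8, 7,
     0, 1, 2]),
   (node (node leaf leaf) (node (node (node leaf leaf) leaf) leaf), [2, 8, 7, 1, 0, 9, 10, 11, 6,
     5, 4, 3]),
   (node leaf (node (node (node (node leaf leaf) leaf) leaf) leaf), [1, 7, 0, 8, 9, 10, 11, 6, 5,
     4, 3, 2]),
   (node leaf (node leaf (node leaf (node leaf (node leaf leaf)))), [0, 7, 1, 8, 2, 9, 3, 10, 4,
     11, 5, 6])]

/-- The plane trees `t` for which `t.closure` is `halinH8`, with the label of the added vertex and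
the labels of the vertices in preorder. -/
def labelsH8 : List (PlaneTree × List ℕ) :=
  [
   (node (node (node (node (node (node (node leaf leaf) leaf) leaf) (node leaf leaf)) leaf) leaf)
     leaf, [0, 10, 11, 12, 13, 15, 16, 17, 9, 8, 7, 6, 14, 5, 4, 3, 2, 1]),
   (node (node (node leaf (node leaf (node leaf leaf))) (node (node (node leaf leaf) leaf) leaf))
     leaf, [4, 14, 13, 12, 3, 11, 2, 10, 1, 0, 15, 16, 17, 9, 8, 7, 6, 5]),
   (node (node (node leaf leaf) (node leaf (node leaf (node leaf leaf)))) (node (node leaf leaf)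
     leaf), [3, 12, 13, 14, 4, 5, 15, 6, 16, 7, 17, 8, 9, 11, 10, 0, 1, 2]),
   (node (node leaf (node (node leaf leaf) (node leaf (node leaf (node leaf leaf))))) (node leaf
     leaf), [2, 11, 12, 3, 13, 14, 4, 5, 15, 6, 16, 7, 17, 8, 9, 10, 0, 1]),
   (node (node leaf (node leaf (node (node leaf leaf) (node leaf (node leaf (node leaf leaf))))))
     leaf, [1, 10, 11, 2, 12, 3, 13, 14, 4, 5, 15, 6, 16, 7, 17, 8, 9, 0]),
   (node (node leaf (node leaf leaf)) (node (node (node (node leaf leaf) leaf) leaf) (node leaf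
     leaf)), [3, 12, 11, 2, 10, 1, 0, 13, 15, 16, 17, 9, 8, 7, 6, 14, 5, 4]),
   (node (node leaf leaf) (node (node (node (node (node leaf leaf) leaf) leaf) (node leaf leaf))
     leaf), [2, 11, 10, 1, 0, 12, 13, 15, 16, 17, 9, 8, 7, 6, 14, 5, 4, 3]),
   (node leaf (node (node (node (node (node (node leaf leaf) leaf) leaf) (node leaf leaf)) leaf)
     leaf), [1, 10, 0, 11, 12, 13, 15, 16, 17, 9, 8, 7, 6, 14, 5, 4, 3, 2]),
   (node leaf (node (node leaf (node leaf (node leaf leaf))) (node (node (node leaf leaf) leaf)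
     leaf)), [4, 14, 5, 13, 15, 6, 16, 7, 17, 8, 9, 12, 11, 10, 0, 1, 2, 3]),
   (node leaf (node leaf (node leaf (node (node leaf leaf) (node leaf (node leaf (node leaf
     leaf)))))), [0, 10, 1, 11, 2, 12, 3, 13, 14, 4, 5, 15, 6, 16, 7, 17, 8, 9])]

theorem nonempty_iso_halinK4 {p : PlaneTree × List ℕ} (hp : p ∈ labelsK4) :
    Nonempty (p.1.closure ≃g halinK4) :=
  IsLabeling.nonempty_iso (n := 4)
    -- The adjacency matrix written as a number; the first `decide` compares it with the graph.
    (M := 0x7bde)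
    (by decide +kernel)
    ((by decide +kernel : ∀ p ∈ labelsK4, IsLabeling _ _ p.1 p.2) p hp)

theorem nonempty_iso_halinH3 {p : PlaneTree × List ℕ} (hp : p ∈ labelsH3) :
    Nonempty (p.1.closure ≃g halinH3) :=
  IsLabeling.nonempty_iso (n := 7)
    (M := 0xb29218b2929a)
    (by decide +kernel)
    ((by decide +kernel : ∀ p ∈ labelsH3, IsLabeling _ _ p.1 p.2) p hp)

theorem nonempty_iso_halinH4 {p : PlaneTree × List ℕ} (hp : p ∈ labelsH4) :
    Nonempty (p.1.closure ≃g halinH4) :=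
  IsLabeling.nonempty_iso (n := 10)
    (M := 0x4c28851083846284508a11462)
    (by decide +kernel)
    ((by decide +kernel : ∀ p ∈ labelsH4, IsLabeling _ _ p.1 p.2) p hp)

theorem nonempty_iso_halinH5 {p : PlaneTree × List ℕ} (hp : p ∈ labelsH5) :
    Nonempty (p.1.closure ≃g halinH5) :=
  IsLabeling.nonempty_iso (n := 12)
    (M := 0x460a1050828410382185042821410a0850c2)
    (by decide +kernel)
    ((by decide +kernel : ∀ p ∈ labelsH5, IsLabeling _ _ p.1 p.2) p hp)

theorem nonempty_iso_halinH8 {p : PlaneTree × List ℕ} (hp : p ∈ labelsH8) :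
    Nonempty (p.1.closure ≃g halinH8) :=
  IsLabeling.nonempty_iso (n := 18)
    (M := 0x40c0280804810020303400028080501008038040602804050080a010140402804050080a010140602)
    (by decide +kernel)
    ((by decide +kernel : ∀ p ∈ labelsH8, IsLabeling _ _ p.1 p.2) p hp)

/-! ### The finite induction on masks -/

namespace PortMask

/-! The following functions evaluate a computed number before it is used. -/

/-- Apply a function to a number. -/
def force {α : Type*} (f : ℕ → α) : ℕ → α
  | 0 => f 0
  | n + 1 => f (Nat.succ n)

/-- Apply a function to a list of numbers. -/
def forceList {α : Type*} (f : List ℕ → α) : List ℕ → α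
  | [] => f []
  | n :: L => force (fun n => forceList (fun L => f (n :: L)) L) n

/-- Apply a function to the entry of a mask. -/
def forceEntry {α : Type*} (f : Entry → α) (A : ℕ) : α :=
  force (fun A => forceList (fun l₂ => forceList (fun l₃ => force (fun r₂ => force (fun r₃ =>
    f ⟨A, l₂, l₃, r₂, r₃⟩) (PortMask.moveRows joins (toThree A)))
      (PortMask.moveRows joins (toTwo A))) (columns (toThree A))) (columns (toTwo A))) A

/-- Apply a function to the list of entries of masks. -/
def forceEntries {α : Type*} (f : List Entry → α) : List ℕ → α
  | [] => f []
  | A :: L => forceEntry (fun x => forceEntries (fun X => f (x :: X)) L) A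

theorem force_eq {α : Type*} (f : ℕ → α) (n : ℕ) : force f n = f n := by
  cases n <;> rfl

theorem forceList_eq {α : Type*} (f : List ℕ → α) (L : List ℕ) : forceList f L = f L := by
  induction L generalizing f with
  | nil => rfl
  | cons n L ih => rw [forceList, force_eq, ih]

theorem forceEntry_eq {α : Type*} (f : Entry → α) (A : ℕ) : forceEntry f A = f (entry A) := by
  simp only [forceEntry, force_eq, forceList_eq, entry]

theorem forceEntries_eq {α : Type*} (f : List Entry → α) (L : List ℕ) :
    forceEntries f L = f (L.map entry) := by
  induction L generalizing f with
  | nil => rfl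
  | cons A L ih => rw [forceEntries, forceEntry_eq, ih, List.map_cons]

/-- The mask of a plane tree. -/
noncomputable def mask : PlaneTree → ℕ
  | leaf => leafMask
  | sub t => force subMask (mask t)
  | node a b => forceEntry (fun x => forceEntry (fun y => nodeMask x y) (mask b)) (mask a)

theorem realizes_mask : ∀ t, Realizes (mask t) t
  | leaf => realizes_leaf
  | sub t => by
    rw [mask, force_eq]
    exact (realizes_mask t).sub
  | node a b => by
    rw [mask, forceEntry_eq, forceEntry_eq]
    exact (realizes_mask a).node (realizes_mask b)

/-- Some mask in the list is contained in `A`. -/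
noncomputable def covers (L : List ℕ) (A : ℕ) : Bool :=
  force (fun A => List.rec false (fun B _ ih => Bool.rec ih true (Nat.beq (Nat.land B A) B)) L) A

theorem exists_realizes_of_covers {L : List ℕ} {A : ℕ} (h : covers L A = true) {t : PlaneTree}
    (ht : Realizes A t) : ∃ B ∈ L, Realizes B t := by
  rw [covers, force_eq] at h
  induction L with
  | nil => exact (Bool.false_ne_true h).elim
  | cons B L ih =>
    cases hB : Nat.beq (Nat.land B A) B with
    | true => exact ⟨B, List.mem_cons_self, ht.of_land_eq (Nat.eq_of_beq_eq_true hB)⟩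
    | false =>
      obtain ⟨C, hC, h⟩ := ih (by simpa only [hB] using h)
      exact ⟨C, List.mem_cons_of_mem _ hC, h⟩

/-- The nodes whose left and right subtrees realize masks from given lists realize a mask in `L`. -/
noncomputable def coversNodes (L : List ℕ) (X Y : List Entry) : Bool :=
  X.all fun x => Y.all fun y => covers L (nodeMask x y)

theorem exists_realizes_node {L K M : List ℕ}
    (h : coversNodes L (K.map entry) (M.map entry) = true) {a b : PlaneTree}
    (ha : ∃ A ∈ K, Realizes A a) (hb : ∃ B ∈ M, Realizes B b) :
    ∃ A ∈ L, Realizes A (a.node b) := by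
  obtain ⟨A, hA, ha⟩ := ha
  obtain ⟨B, hB, hb⟩ := hb
  exact exists_realizes_of_covers (List.all_eq_true.1 (List.all_eq_true.1 h _
    (List.mem_map_of_mem hA)) _ (List.mem_map_of_mem hB)) (ha.node hb)

/-- The plane trees with an exceptional closure. -/
def exceptional : List PlaneTree :=
  (labelsK4 ++ labelsH3 ++ labelsH4 ++ labelsH5 ++ labelsH8).map Prod.fst

/-- All proper subtrees of the exceptional trees, and the exceptional trees. -/
def trees : List PlaneTree :=
  [leaf, sub leaf, node leaf (sub leaf), node (sub leaf) leaf, node (node leaf leaf) leaf,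
   node leaf (node leaf leaf), node (node (node leaf leaf) leaf) leaf,
   node leaf (node leaf (node leaf leaf)),
   node (node (node (node leaf leaf) leaf) leaf) (node leaf leaf),
   node (node leaf leaf) (node leaf (node leaf (node leaf leaf))),
   node (node (node (node (node leaf leaf) leaf) leaf) (node leaf leaf)) leaf,
   node leaf (node (node leaf leaf) (node leaf (node leaf (node leaf leaf)))),
   node (node (node (node (node (node leaf leaf) leaf) leaf) (node leaf leaf)) leaf) leaf,
   node (node leaf (node leaf (node leaf leaf))) (node (node (node leaf leaf) leaf) leaf),
   node leaf (node leaf (node (node leaf leaf) (node leaf (node leaf (node leaf leaf)))))]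
  ++ exceptional

/-- A mask realized by all paths with at least three vertices. -/
def pathMask : ℕ := 0x600a00c000c0140180010020000003005006

/-- Masks such that one of them is realized by every plane tree that is neither a path nor one of
`trees`. -/
def masks : List ℕ :=
  [0x40000120200000810200040000400080000, 0x7007006000000000,
   0x220220220050050050000000000000000000, 0x80080000400400000800100000a00140b40,
   0x1c4144004e02a02002000000000000000000, 0x2000400004b04b04b0,
   0x3e200000051d0000000000000000000, 0x1f8e38000000000000, 0x10000010020000020240240000005003006,
   0x400800000080100000010020000203045006, 0x1c7000000e07000000000000000000, 0x80400000058228278,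
   0x1c00040a0e00002410000000000000000000, 0x11000000021000e011c1000800100d80,
   0x407214005087062003000000000000000000, 0xe000000001c0290460000000000000,
   0x80000000400000c00180fc6000000000, 0x40045060200203210200040000000000000,
   0x10000030020000030040200000005003006, 0x40000040200000200000000000270270030,
   0x800000000100000080400000286446240, 0x200c00000040180e001c0d80000000000,
   0x100003000800005080400006040200030, 0x10010010020020020240240240000000000,
   0x2a0420000450090010020000040200000, 0x220068000050218000000000000008008240,
   0x1a5000000c13c00180000000000000, 0x103805246000000000, 0x10050010020220020030030030040200240,
   0x90050000420220201041000000000000, 0xe0028000610018000000000000208048000,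
   0x801000000101000000200040000d00980d80, 0x404000000082000001001000a10160030,
   0x880200000500040211061000000000000, 0x18050200028220040038038000000000240,
   0xc00000800180000100040200030085403000, 0x3a10000005160003005030000000000,
   0x2000000000400482080000100204b0, 0x200040290040200460028018030000000000,
   0x210010210060020060030030030000000000, 0x40200240078238030,
   0x192004000c24002182c04000000000000, 0x200210420040060090028018000000000000,
   0x42082080204404400400080000200040240, 0x80106000400806c80580000000000000,
   0xa30000000170007007000000000000, 0x58050070228220230000000000000000000,
   0x18010000028020000230070240000000000, 0x4300504002840882080400000010020000,
   0xe000000001c06000c0030000000000, 0x82500c20404880190000000000180c00000,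
   0x8000000008000000068218000038038270, 0x9001a00042002c130830006000000000,
   0x880202000500044880500006000000000, 0x50000040220000200000000000058228030,
   0x120000000810300840000400080d80, 0x200820004040110002008008000002004006,
   0x8006000001000c0290460000000000000, 0x100100100800800800c00180480a00140000,
   0x800000c0400000600048208030000000240, 0x50200000220040090420000048208240,
   0x40040020200200010220050270000000000, 0x14002c000a0001a028018486000000000,
   0x28000008018000008230070240048208000, 0x800281000100441090420006000000000,
   0x840401400300081080200040000d00980900, 0x50048040220208200030030000048208000,
   0xc00582906002284604100a04b0000000000, 0x30020000030010000260250000200040240,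
   0x200440030040280030008008000000000030, 0x200000220040000050040200240030030030,
   0xa830000005451108204b0000000000, 0x220228000050058000000000000008008000,
   0x5001001008808008000b0430000202044240, 0x20100006010800006082404000104802006,
   0x60060060210210210000000000240240000, 0x120004020810002010800100000030030000,
   0x6380882000f8408040080400000008008000, 0x80000280400000440200040030020010240,
   0x110092000820424401081000048208000, 0x8040040008200200000000030048208278,
   0x6240100000d2020000008008000001001006, 0x68008000218008000048208000030030030,
   0x1c2000000e04006006006000000000, 0x50060020220210010200040000000000000,
   0x40000540200000a80200040000800100930, 0x182000004c04000002000000000980d00b40,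
   0x200010070040020230000000000060210000, 0x201000060108000066000c0006040200000,
   0x207406000047086000200040000030030480, 0x2280a8000058418000080400000200040000,
   0x200280000100180602100006080c8000, 0x80000020400000010b00940000120810480,
   0xe0000008610000008070230240008008000, 0x90440810420280120300840900004002000,
   0x440180800280c00100300840000000000900, 0x6000022800c0004440020010930002004000,
   0x184144000c02a02000000000000a00140000, 0x40010040200020200000000000270270000]

/-- Masks such that one of them is realized by every plane tree in `trees` and by every path. -/
def lowerMasks : List ℕ :=
  [0x200400000040080008008030000000000, 0x104000000802c00180487000000000,
   0x60028000210018000000000000208048008, 0x18048008028208008028018000008008240,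
   0x81000000401120810ff6000000000, 0x40000000200040200240070230030,
   0x5a00000022c007007000000000000, 0x40000030200000030200040030200040000,
   0x124000000812248248000000000000, 0x3a10000005160003005000000000000,
   0x5e5de51c0e93f93e00c00180000c00180d80, 0x90040000420200080400000000000000, 0x2004000,
   0x200000200040000040000000000010020030, 0xa00000000140803105000000000000,
   0x4284c8008098688008090420000040200240, 0xc900830005a0405810120fc0000000000]

/-- The closure property on which the induction rests: two subtrees that realize members of the list
yield a node that does so too. -/
theorem coversNodes_masks : coversNodes masks (masks.map entry) (masks.map entry) = true := by
  have h : forceEntries (fun X => coversNodes masks X X) masks = true := by decide +kernel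
  rwa [forceEntries_eq] at h

/-- Next to a subtree that realizes a member of `masks`, coarse information on the other subtree is
enough; a few weak masks stand for all exceptions and paths. -/
theorem coversNodes_lowerMasks : coversNodes masks (masks.map entry) (lowerMasks.map entry) = true ∧
    coversNodes masks (lowerMasks.map entry) (masks.map entry) = true := by
  have h : forceEntries (fun X => forceEntries (fun Y =>
      coversNodes masks X Y && coversNodes masks Y X) lowerMasks) masks = true := by decide +kernel
  rwa [forceEntries_eq, forceEntries_eq, Bool.and_eq_true] at h

theorem coversNodes_pathMask :
    coversNodes masks [entry pathMask] ((pathMask :: trees.map mask).map entry) = true ∧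
      coversNodes masks ((trees.map mask).map entry) [entry pathMask] = true := by
  have h : forceEntry (fun x => forceEntries (fun Y =>
      coversNodes masks [x] (x :: Y) && coversNodes masks Y [x]) (trees.map mask)) pathMask =
        true := by decide +kernel
  rwa [forceEntry_eq, forceEntries_eq, Bool.and_eq_true] at h

theorem coversNodes_trees : ∀ a ∈ trees, ∀ b ∈ trees,
    covers masks (nodeMask (entry (mask a)) (entry (mask b))) = true ∨ node a b ∈ trees := by
  have h : forceEntries (fun X => (trees.zip X).all fun x => (trees.zip X).all fun y =>
      covers masks (nodeMask x.2 y.2) || decide (node x.1 y.1 ∈ trees)) (trees.map mask) = true := by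
    decide +kernel
  rw [forceEntries_eq, List.map_map, List.all_eq_true] at h
  have hmem : ∀ {L : List PlaneTree} {f : PlaneTree → Entry}, ∀ a ∈ L, (a, f a) ∈ L.zip (L.map f) :=
    fun {L f} a ha => by
      obtain ⟨k, hk, rfl⟩ := List.getElem_of_mem ha
      exact List.mem_iff_getElem.2 ⟨k, by simpa using hk, by simp⟩
  intro a ha b hb
  have := List.all_eq_true.1 (h _ (hmem a ha)) _ (hmem b hb)
  rwa [Bool.or_eq_true, decide_eq_true_eq] at this

theorem covers_sub_masks : ∀ A ∈ masks, covers masks (subMask A) = true := by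
  decide +kernel

theorem covers_sub_trees : ∀ t ∈ trees,
    sub t ∈ trees ∨ t = sub leaf ∨ covers masks (subMask (mask t)) = true := by
  decide +kernel

theorem covers_lowerMasks_trees : ∀ t ∈ trees, covers lowerMasks (mask t) = true := by
  decide +kernel

theorem closable_masks : ∀ A ∈ masks, closable A = true := by
  decide +kernel

theorem closable_trees : ∀ t ∈ trees,
    t = leaf ∨ t = sub leaf ∨ closable (mask t) = true ∨ t ∈ exceptional := by
  decide +kernel

theorem leaf_mem_trees : leaf ∈ trees := by
  decide +kernel

/-- Lengthening the stem maps `pathMask` to a superset of itself, so one mask handles all long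
paths. -/
theorem realizes_pathMask_sub {t : PlaneTree} (h : Realizes pathMask t) :
    Realizes pathMask t.sub :=
  h.sub.of_land_eq (by decide +kernel)

theorem realizes_pathMask_sub_sub_leaf : Realizes pathMask leaf.sub.sub :=
  realizes_leaf.sub.sub.of_land_eq (by decide +kernel)

/-- Every plane tree is one of finitely many exceptions, or a path, or realizes one of finitely many
masks. -/
theorem mem_trees_or_realizes (t : PlaneTree) :
    t ∈ trees ∨ (t.IsPath ∧ Realizes pathMask t) ∨ ∃ A ∈ masks, Realizes A t := by
  have hmask : ∀ {t}, t ∈ trees → ∃ A ∈ trees.map mask, Realizes A t := fun ht =>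
    ⟨_, List.mem_map_of_mem ht, realizes_mask _⟩
  have hlow : ∀ {t}, (t ∈ trees ∨ t.IsPath ∧ Realizes pathMask t) →
      ∃ A ∈ lowerMasks, Realizes A t := by
    rintro t (ht | ⟨-, ht⟩)
    · exact exists_realizes_of_covers (covers_lowerMasks_trees t ht) (realizes_mask t)
    · exact exists_realizes_of_covers (by decide +kernel) ht
  induction t with
  | leaf => exact Or.inl leaf_mem_trees
  | sub t ih =>
    rcases ih with ht | ⟨h, ht⟩ | ⟨A, hA, ht⟩
    · rcases covers_sub_trees t ht with h | rfl | h
      · exact Or.inl h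
      -- The path with three vertices, where `pathMask` takes over from the list `trees`.
      · exact Or.inr (Or.inl ⟨trivial, realizes_pathMask_sub_sub_leaf⟩)
      · exact Or.inr (Or.inr (exists_realizes_of_covers h (realizes_mask t).sub))
    · exact Or.inr (Or.inl ⟨h, realizes_pathMask_sub ht⟩)
    · exact Or.inr (Or.inr (exists_realizes_of_covers (covers_sub_masks A hA) ht.sub))
  | node a b iha ihb =>
    -- Exceptions and paths are grouped together: coarse masks suffice unless both subtrees are of
    -- this kind, and only then are the masks of the individual trees needed.
    rw [← or_assoc] at iha ihb
    rcases iha with ha | ha <;> rcases ihb with hb | hb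
    · rcases ha with ha | ⟨-, ha⟩ <;> rcases hb with hb | ⟨-, hb⟩
      · rcases coversNodes_trees a ha b hb with h | h
        · exact Or.inr (Or.inr (exists_realizes_of_covers h
            ((realizes_mask a).node (realizes_mask b))))
        · exact Or.inl h
      · exact Or.inr (Or.inr (exists_realizes_node coversNodes_pathMask.2 (hmask ha)
          (M := [pathMask]) ⟨_, List.mem_singleton_self _, hb⟩))
      · obtain ⟨B, hB, hb⟩ := hmask hb
        exact Or.inr (Or.inr (exists_realizes_node (K := [pathMask]) coversNodes_pathMask.1
          ⟨_, List.mem_singleton_self _, ha⟩ ⟨B, List.mem_cons_of_mem _ hB, hb⟩))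
      · exact Or.inr (Or.inr (exists_realizes_node (K := [pathMask]) coversNodes_pathMask.1
          ⟨_, List.mem_singleton_self _, ha⟩ ⟨_, List.mem_cons_self, hb⟩))
    · exact Or.inr (Or.inr (exists_realizes_node coversNodes_lowerMasks.2 (hlow ha) hb))
    · exact Or.inr (Or.inr (exists_realizes_node coversNodes_lowerMasks.1 ha (hlow hb)))
    · exact Or.inr (Or.inr (exists_realizes_node coversNodes_masks ha hb))

/-- Apart from the exceptional trees, all plane trees that are not paths have a closure with a total
coloring in four colors. -/
theorem mem_exceptional_or_exists_coloring {t : PlaneTree} (ht : ¬ t.IsPath) :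
    t ∈ exceptional ∨ ∃ (c : Option t.Vert → Fin 4) (e : Option t.Vert → Option t.Vert → Fin 4),
      IsTotalColoring t.closure.Adj c e := by
  rcases mem_trees_or_realizes t with h | ⟨h, -⟩ | ⟨A, hA, h⟩
  · rcases closable_trees t h with rfl | rfl | h | h
    · exact (ht trivial).elim
    · exact (ht trivial).elim
    · exact Or.inr ((realizes_mask t).exists_closure_coloring ht h)
    · exact Or.inl h
  · exact (ht h).elim
  · exact Or.inr (h.exists_closure_coloring ht (closable_masks A hA))

end PortMask

/-! ### The theorem -/

theorem theorem3 {V : Type*} [Fintype V] (H : SimpleGraph V) [DecidableRel H.Adj]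
    (hHalin : IsHalin H) (hsubcubic : H.maxDegree ≤ 3)
    (hK4 : IsEmpty (H ≃g halinK4)) (hH4 : IsEmpty (H ≃g halinH4)) (hH5 : IsEmpty (H ≃g halinH5))
    (hH8 : IsEmpty (H ≃g halinH8)) (hH3 : IsEmpty (H ≃g halinH3)) :
    totalChromaticNumber H = 4 := by
  obtain ⟨t, ht, ⟨f⟩⟩ := hHalin.exists_iso_closure hsubcubic
  obtain h | ⟨c, e, h⟩ := PortMask.mem_exceptional_or_exists_coloring ht
  · exfalso
    obtain ⟨p, hp, rfl⟩ := List.mem_map.1 h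
    simp only [List.mem_append] at hp
    rcases hp with (((hp | hp) | hp) | hp) | hp
    · exact (nonempty_iso_halinK4 hp).elim fun g => hK4.false (f.trans g)
    · exact (nonempty_iso_halinH3 hp).elim fun g => hH3.false (f.trans g)
    · exact (nonempty_iso_halinH4 hp).elim fun g => hH4.false (f.trans g)
    · exact (nonempty_iso_halinH5 hp).elim fun g => hH5.false (f.trans g)
    · exact (nonempty_iso_halinH8 hp).elim fun g => hH8.false (f.trans g)
  · exact totalChromaticNumber_eq_four ht f h
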